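/- Let $0<\alpha<H<1$, $\sigma\in\mathbb R\setminus\{0\}$, and let $b:(0,\infty)\to\mathbb R$ satisfy the following assumption. (1) $b$ is $[1/\alpha]+1$ times continuously differentiable on $(0,\infty)$, and for every $\varepsilon>0$ its derivatives of orders $1,\dots,[1/\alpha]+1$ are bounded on $[\varepsilon,\infty)$. (2) There is $K>0$ with $b'(x)<-K$ for all $x>0$. (3) There is $R>0$ with $b(x)>-Rx$ for all $x>0$. (4) For every $C>0$, either $\int_0^T b(Ct^\alpha)\,dt=\infty$ for all $T>0$, or $\lim_{T\to0^+}T^{-\alpha}\int_0^T b(Ct^\alpha)\,dt=\infty$. Let $\Omega$ be the set of locally $\alpha$-Hölder continuous functions $\omega:\mathbb R\to\mathbb R$ with $\omega_0=0$, equipped with the $\sigma$-algebra generated by the coordinate maps, and let $\mathbb P$ be a probability measure on $\Omega$ under which the canonical process $B_t(\omega)=\omega_t$, $t\in\mathbb R$, is a two-sided fractional Brownian motion of Hurst parameter $H$ (a centered Gaussian process with $\mathbb E[B_sB_t]=\frac12(|s|^{2H}+|t|^{2H}-|t-s|^{2H})$). Let $\theta_t\omega:=\omega_{t+\cdot}-\omega_t$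 be the Wiener shift. Then, for every $\omega\in\Omega$ and $x_0>0$, the equation $$X_t=x_0+\int_0^t b(X_s)\,ds+\sigma B_t(\omega),\qquad t\ge 0,$$ has a unique continuous $(0,\infty)$-valued solution $X(x_0,\omega)$ on $[0,\infty)$; and as $x_0\downarrow0$, $X(x_0,\omega)$ converges uniformly on every interval $[0,T]$ to a limit, denoted by $X(0,\omega)$. Moreover, there is a random variable $X^*:\Omega\to[0,\infty)$, belonging to $L^p(\Omega,\mathbb P)$ for every $p>0$, such that: (a) for every $x_0\ge0$, $|X_T(x_0)-X^*\circ\theta_T|\to0$ as $T\to\infty$, almost surely and in $L^p(\Omega,\mathbb P)$ for every $p>0$; (b) $(X^*\circ\theta_t)_{t\ge0}$ is a stationary solution of the equation: almost surely, $X_t(X^*(\omega),\omega)=X^*(\theta_t\omega)$ for all $t\ge0$, and for every $s\ge0$ the processes $(X^*\circ\theta_{t+s})_{t\ge0}$ and $(X^*\circ\theta_t)_{t\ge0}$ have the same distribution. -/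

import Mathlib

open MeasureTheory ProbabilityTheory Filter Topology Set

namespace SingularSDE

noncomputable section

/-- The assumption on the drift `b`, with respect to the regularity exponent `α` of the noise.
Only the values of `b` on `(0, ∞)` matter. -/
structure DriftAssumption (α : ℝ) (b : ℝ → ℝ) : Prop where
  /-- `b` is `[1/α] + 1` times continuously differentiable on `(0, ∞)`. -/
  contDiffOn : ContDiffOn ℝ ((⌊1 / α⌋₊ + 1 : ℕ) : WithTop ℕ∞) b (Ioi 0)
  /-- The derivatives of `b` are bounded on `[ε, ∞)` for every `ε > 0`. -/
  bounded_deriv : ∀ ε : ℝ, 0 < ε → ∀ k : ℕ, 1 ≤ k → k ≤ ⌊1 / α⌋₊ + 1 →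
    ∃ M : ℝ, ∀ x : ℝ, ε ≤ x → |iteratedDeriv k b x| ≤ M
  /-- The derivative of `b` is bounded above by a negative constant. -/
  deriv_lt : ∃ K : ℝ, 0 < K ∧ ∀ x : ℝ, 0 < x → deriv b x < -K
  /-- `b` is bounded below by a linear function. -/
  lower_bound : ∃ R : ℝ, 0 < R ∧ ∀ x : ℝ, 0 < x → -(R * x) < b x
  /-- `b` is singular enough at `0`. Since `b` is bounded below near `0`, the integral
  `∫_0^T b(C t^α) dt` equals `+∞` iff the integral of the positive part does. -/
  singular : ∀ C : ℝ, 0 < C →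
    (∀ T : ℝ, 0 < T → ∫⁻ t in Ioc 0 T, ENNReal.ofReal (b (C * t ^ α)) = ⊤) ∨
    Tendsto (fun T : ℝ => 1 / T ^ α * ∫ t in (0 : ℝ)..T, b (C * t ^ α)) (𝓝[>] 0) atTop

/-- `x` is a positive solution on `[0, ∞)` of `x_t = x₀ + ∫_0^t b(x_s) ds + σ w_t`. -/
structure IsPositiveSolution (b : ℝ → ℝ) (σ : ℝ) (w : ℝ → ℝ) (x₀ : ℝ) (x : ℝ → ℝ) : Prop where
  continuousOn : ContinuousOn x (Ici 0)
  pos : ∀ t : ℝ, 0 ≤ t → 0 < x t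
  eqn : ∀ t : ℝ, 0 ≤ t → x t = x₀ + (∫ s in (0 : ℝ)..t, b (x s)) + σ * w t

open Classical in
/-- A positive solution started at `x₀` (and `0` if there is none). -/
def positiveSolution (b : ℝ → ℝ) (σ : ℝ) (w : ℝ → ℝ) (x₀ : ℝ) : ℝ → ℝ :=
  if h : ∃ x : ℝ → ℝ, IsPositiveSolution b σ w x₀ x then h.choose else 0

/-- The solution map `x_t(x₀, w)` for `x₀ ≥ 0`: the positive solution if `x₀ > 0`, extended to
`x₀ = 0` as the limit when the initial condition decreases to `0`. -/
def itoMap (b : ℝ → ℝ) (σ : ℝ) (w : ℝ → ℝ) (x₀ t : ℝ) : ℝ :=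
  if 0 < x₀ then positiveSolution b σ w x₀ t
  else limUnder (𝓝[>] (0 : ℝ)) (fun y : ℝ => positiveSolution b σ w y t)

/-- Local `α`-Hölder continuity on `ℝ`: Hölder continuity on every compact interval. -/
def IsLocallyHolder (α : ℝ) (w : ℝ → ℝ) : Prop :=
  ∀ R : ℝ, ∃ C : ℝ, ∀ s ∈ Icc (-R) R, ∀ t ∈ Icc (-R) R, |w t - w s| ≤ C * |t - s| ^ α

/-- The canonical path space: locally `α`-Hölder continuous paths `ω : ℝ → ℝ` with `ω 0 = 0`.
As a subtype of `ℝ → ℝ` it carries the `σ`-algebra generated by the coordinate maps. -/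
abbrev PathSpace (α : ℝ) : Type :=
  {ω : ℝ → ℝ // ω 0 = 0 ∧ IsLocallyHolder α ω}

/-- The canonical process on the path space. -/
def canonicalProcess (α : ℝ) (t : ℝ) (ω : PathSpace α) : ℝ := ω.1 t

theorem IsLocallyHolder.shift {α : ℝ} {w : ℝ → ℝ} (hw : IsLocallyHolder α w) (t : ℝ) :
    IsLocallyHolder α (fun u => w (t + u) - w t) := by
  intro R
  obtain ⟨C, hC⟩ := hw (R + |t|)
  refine ⟨C, fun s hs u hu => ?_⟩
  have h1 := neg_abs_le t
  have h2 := le_abs_self t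
  have h := hC (t + s) ⟨by linarith [hs.1], by linarith [hs.2]⟩
    (t + u) ⟨by linarith [hu.1], by linarith [hu.2]⟩
  have e1 : w (t + u) - w t - (w (t + s) - w t) = w (t + u) - w (t + s) := by ring
  have e2 : t + u - (t + s) = u - s := by ring
  rw [e2] at h
  rw [e1]
  exact h

/-- The Wiener shift `θ_t ω = ω_{t + ·} - ω_t`. -/
def wienerShift {α : ℝ} (t : ℝ) (ω : PathSpace α) : PathSpace α :=
  ⟨fun u => ω.1 (t + u) - ω.1 t, by simp, ω.2.2.shift t⟩

/-- `B` is a two-sided fractional Brownian motion of Hurst parameter `H` under `P`: a centered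
Gaussian process with covariance `(|s|^{2H} + |t|^{2H} - |t - s|^{2H}) / 2`. -/
structure IsTwoSidedFBM {Ω : Type*} [MeasurableSpace Ω] (H : ℝ) (B : ℝ → Ω → ℝ)
    (P : Measure Ω) : Prop where
  gaussian : IsGaussianProcess B P
  centered : ∀ t : ℝ, ∫ ω, B t ω ∂P = 0
  covariance : ∀ s t : ℝ, ∫ ω, B s ω * B t ω ∂P =
    (|s| ^ (2 * H) + |t| ^ (2 * H) - |t - s| ^ (2 * H)) / 2

/-- The process `X_t(x₀, ω) = x_t(x₀, B(ω))`, where `B(ω) = ω` is the canonical process. -/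
def solution (b : ℝ → ℝ) (σ : ℝ) {α : ℝ} (x₀ t : ℝ) (ω : PathSpace α) : ℝ :=
  itoMap b σ (fun s => canonicalProcess α s ω) x₀ t

end

end SingularSDE

/-! Two properties of the drift carry the proof. First, `b' < -K` makes the flow a contraction: for
two positive solutions with the same noise the noise cancels in the difference `d`, and `d ^ 2 * exp
(2 * K * t)` is nonincreasing, so `|x_t - y_t| ≤ exp (-K t) |x_0 - y_0|`
(`abs_sub_le_exp_mul_of_eqn`). This gives uniqueness, the limit as the starting point decreases to
`0`, and exponential forgetting of the starting point. Second, the singularity at `0` beats the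
noise. A Hölder path moves by at most `C h ^ α` in time `h`, while for a suitable `h` the integral
of `b` along the curve `ε + C u ^ α` exceeds `C h ^ α` for all small `ε` (`exists_lt_integral`). A
solution that came down to a small level `ε` would have been below that curve just before, and the
drift would already have pushed it up by more than the noise could take away. Hence solutions of the
equation with drift `b (max x ε)`, which is Lipschitz and solvable by Picard iteration, stay above
`ε` for small `ε` and so solve the original equation.

The stationary solution is obtained by pullback: start from `1` at time `-n`, look at time `0`, and
let `n → ∞`. By the flow property and the contraction, consecutive pullbacks differ by at most `exp
(-K n)` times the displacement in one unit of time of a solution started from `1`. That displacement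
has finite moments, because the supremum of fractional Brownian motion on a bounded interval does
(`exists_memLp_bound`), and its law does not depend on `n`, because the Wiener shift preserves `P`;
so the differences are almost surely summable. The `L^q` norms of the pullbacks satisfy `a_{n+1} ≤ c
+ ρ a_n` with `ρ < 1`, so they are bounded, and Fatou's lemma passes the bound to the limit.
Attraction of every solution is then the contraction estimate once more. -/

namespace SingularSDE

/-! ### Picard iteration for Lipschitz drifts -/

/-- The Picard iterates of the integral equation `x_t = g_t + ∫_0^t f(x_s) ds`. -/
noncomputable def picardIterate (f g : ℝ → ℝ) : ℕ → ℝ → ℝ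
  | 0 => g
  | k + 1 => fun t => g t + ∫ s in (0 : ℝ)..t, f (picardIterate f g k s)

theorem continuous_picardIterate {f g : ℝ → ℝ} (hf : Continuous f) (hg : Continuous g) (k : ℕ) :
    Continuous (picardIterate f g k) := by
  induction k with
  | zero => exact hg
  | succ k ih =>
    exact hg.add (intervalIntegral.continuous_primitive
      (fun a b => (hf.comp ih).intervalIntegrable a b) 0)

/-- A function continuous in time and measurable in `ω` is jointly measurable, so each time integral
is again measurable in `ω`. -/
theorem measurable_picardIterate {Ω : Type*} [MeasurableSpace Ω] {f : ℝ → ℝ} (hf : Continuous f)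
    {g : Ω → ℝ → ℝ} (hg : ∀ ω, Continuous (g ω)) (hgm : ∀ t, Measurable fun ω => g ω t)
    (k : ℕ) (t : ℝ) : Measurable fun ω => picardIterate f (g ω) k t := by
  induction k generalizing t with
  | zero => exact hgm t
  | succ k ih =>
    have h1 : Measurable (Function.uncurry fun s ω => f (picardIterate f (g ω) k s)) :=
      measurable_uncurry_of_continuous_of_measurable
        (fun ω => hf.comp (continuous_picardIterate hf (hg ω) k))
        (fun s => hf.measurable.comp (ih s))
    have h2 : ∀ a b : ℝ, Measurable fun ω => ∫ s in Ioc a b, f (picardIterate f (g ω) k s) :=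
      fun a b => (StronglyMeasurable.integral_prod_right'
        (f := fun p : Ω × ℝ => f (picardIterate f (g p.1) k p.2)) (ν := volume.restrict (Ioc a b))
        (h1.comp measurable_swap).stronglyMeasurable).measurable
    exact (hgm t).add ((h2 0 t).sub (h2 t 0))

/-- Integrating the Lipschitz bound `k` times produces the factorial. The bounds are therefore
summable on every bounded interval, and no restarting on short intervals is needed. -/
theorem abs_picardIterate_succ_sub_le {f g : ℝ → ℝ} {L : ℝ} (hL : 0 ≤ L)
    (hf : ∀ x y, |f x - f y| ≤ L * |x - y|) (hfc : Continuous f) (hg : Continuous g) {T M : ℝ}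
    (hM : ∀ t ∈ Icc 0 T, |picardIterate f g 1 t - g t| ≤ M) (k : ℕ) :
    ∀ t ∈ Icc 0 T, |picardIterate f g (k + 1) t - picardIterate f g k t| ≤
      M * ((L * t) ^ k / k.factorial) := by
  induction k with
  | zero => intro t ht; simpa [picardIterate] using hM t ht
  | succ k ih =>
    intro t ht
    have hc : ∀ j, Continuous fun s => f (picardIterate f g j s) :=
      fun j => hfc.comp (continuous_picardIterate hfc hg j)
    have e : picardIterate f g (k + 1 + 1) t - picardIterate f g (k + 1) t =
        ∫ s in (0 : ℝ)..t, (f (picardIterate f g (k + 1) s) - f (picardIterate f g k s)) := by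
      have hi : ∀ j, IntervalIntegrable (fun s => f (picardIterate f g j s)) volume 0 t :=
        fun j => (hc j).intervalIntegrable 0 t
      rw [intervalIntegral.integral_sub (hi (k + 1)) (hi k)]
      have hs : ∀ j, picardIterate f g (j + 1) t =
        g t + ∫ s in (0 : ℝ)..t, f (picardIterate f g j s) := fun _ => rfl
      rw [hs, hs]
      ring
    have hb : Continuous fun s : ℝ => L * (M * ((L * s) ^ k / k.factorial)) := by fun_prop
    have h1 : ‖∫ s in (0 : ℝ)..t, (f (picardIterate f g (k + 1) s) - f (picardIterate f g k s))‖ ≤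
        ∫ s in (0 : ℝ)..t, L * (M * ((L * s) ^ k / k.factorial)) := by
      refine intervalIntegral.norm_integral_le_of_norm_le ht.1 (ae_of_all _ fun s hs => ?_)
        (hb.intervalIntegrable (μ := volume) _ _)
      exact (hf _ _).trans
        (mul_le_mul_of_nonneg_left (ih s ⟨hs.1.le, hs.2.trans ht.2⟩) hL)
    rw [e, ← Real.norm_eq_abs]
    refine h1.trans (le_of_eq ?_)
    have e2 : (fun s : ℝ => L * (M * ((L * s) ^ k / k.factorial))) =
        fun s => (L * (M * (L ^ k / k.factorial))) * s ^ k := by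
      funext s; rw [mul_pow]; ring
    rw [e2, intervalIntegral.integral_const_mul, integral_pow, Nat.factorial_succ]
    have h3 : ((k.factorial : ℕ) : ℝ) ≠ 0 := by positivity
    have h4 : (k : ℝ) + 1 ≠ 0 := by positivity
    push_cast
    field_simp
    ring

/-- Picard iterates of an equation with Lipschitz drift converge to a solution on `[0, ∞)`. -/
theorem exists_tendsto_picardIterate {f g : ℝ → ℝ} {L : ℝ} (hL : 0 ≤ L)
    (hf : ∀ x y, |f x - f y| ≤ L * |x - y|) (hg : Continuous g) :
    ∃ x : ℝ → ℝ, ContinuousOn x (Ici 0) ∧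
      (∀ t, 0 ≤ t → x t = g t + ∫ s in (0 : ℝ)..t, f (x s)) ∧
      ∀ t, 0 ≤ t → Tendsto (fun k => picardIterate f g k t) atTop (𝓝 (x t)) := by
  have hfc : Continuous f :=
    (LipschitzWith.of_dist_le_mul (K := ⟨L, hL⟩) fun x y => hf x y).continuous
  have hpc := continuous_picardIterate hfc hg
  have key : ∀ T : ℝ, 0 ≤ T → ∃ u : ℕ → ℝ, Summable u ∧ ∀ t ∈ Icc 0 T, ∀ k,
      dist (picardIterate f g k t) (picardIterate f g k.succ t) ≤ u k := by
    intro T hT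
    obtain ⟨M, hM⟩ := (isCompact_Icc (a := (0 : ℝ)) (b := T)).exists_bound_of_continuousOn
      ((hpc 1).sub hg).continuousOn
    have hM0 : 0 ≤ M := (norm_nonneg _).trans (hM 0 ⟨le_rfl, hT⟩)
    refine ⟨fun k => M * ((L * T) ^ k / k.factorial),
      (Real.summable_pow_div_factorial (L * T)).mul_left M, fun t ht k => ?_⟩
    rw [dist_comm, Real.dist_eq]
    refine (abs_picardIterate_succ_sub_le hL hf hfc hg hM k t ht).trans ?_
    have h1 : L * t ≤ L * T := mul_le_mul_of_nonneg_left ht.2 hL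
    have h2 : 0 ≤ L * t := mul_nonneg hL ht.1
    dsimp only
    gcongr
  have hlim : ∀ t : ℝ, ∃ y, 0 ≤ t → Tendsto (fun k => picardIterate f g k t) atTop (𝓝 y) := by
    intro t
    by_cases ht : 0 ≤ t
    · obtain ⟨u, hu, h⟩ := key t ht
      obtain ⟨y, hy⟩ := cauchySeq_tendsto_of_complete
        (cauchySeq_of_dist_le_of_summable u (h t ⟨ht, le_rfl⟩) hu)
      exact ⟨y, fun _ => hy⟩
    · exact ⟨0, fun h => absurd h ht⟩
  choose x hx using hlim
  have hunif : ∀ T, 0 ≤ T → TendstoUniformlyOn (picardIterate f g) x atTop (Icc 0 T) := by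
    intro T hT
    obtain ⟨u, hu, h⟩ := key T hT
    rw [Metric.tendstoUniformlyOn_iff]
    intro ε hε
    filter_upwards [(tendsto_order.1 (tendsto_sum_nat_add u)).2 ε hε] with n hn t ht
    rw [dist_comm]
    refine (dist_le_tsum_of_dist_le_of_tendsto u (h t ht) hu (hx t ht.1) n).trans_lt ?_
    simpa only [add_comm] using hn
  have hxc : ∀ T, 0 ≤ T → ContinuousOn x (Icc 0 T) := fun T hT =>
    (hunif T hT).continuousOn (Eventually.frequently (Eventually.of_forall
      fun k => (hpc k).continuousOn))
  refine ⟨x, ?_, fun t ht => ?_, fun t ht => hx t ht⟩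
  · intro t ht
    have h1 := hxc (t + 1) (by linarith [mem_Ici.1 ht]) t ⟨ht, by linarith⟩
    refine h1.mono_of_mem_nhdsWithin ?_
    rw [← Ici_inter_Iic]
    exact inter_mem self_mem_nhdsWithin (mem_nhdsWithin_of_mem_nhds (Iic_mem_nhds (by linarith)))
  · have h1 : Tendsto (fun k => ∫ s in (0 : ℝ)..t, f (picardIterate f g k s)) atTop
        (𝓝 (∫ s in (0 : ℝ)..t, f (x s))) := by
      rw [Metric.tendsto_atTop]
      intro ε hε
      have h2 := (Metric.tendstoUniformlyOn_iff.1 (hunif t ht)) (ε / (L * t + 1))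
        (by positivity)
      obtain ⟨N, hN⟩ := eventually_atTop.1 h2
      refine ⟨N, fun n hn => ?_⟩
      have hi1 : IntervalIntegrable (fun s => f (picardIterate f g n s)) volume 0 t :=
        (hfc.comp (hpc n)).intervalIntegrable _ _
      have hi2 : IntervalIntegrable (fun s => f (x s)) volume 0 t :=
        ContinuousOn.intervalIntegrable
          (by rw [uIcc_of_le ht]; exact hfc.comp_continuousOn (hxc t ht))
      rw [Real.dist_eq, ← intervalIntegral.integral_sub hi1 hi2]
      have h3 : ‖∫ s in (0 : ℝ)..t, (f (picardIterate f g n s) - f (x s))‖ ≤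
          (L * (ε / (L * t + 1))) * |t - 0| := by
        refine intervalIntegral.norm_integral_le_of_norm_le_const fun s hs => ?_
        rw [uIoc_of_le ht] at hs
        refine (hf _ _).trans (mul_le_mul_of_nonneg_left ?_ hL)
        have := hN n hn s ⟨hs.1.le, hs.2⟩
        rw [dist_comm] at this
        exact this.le
      refine h3.trans_lt ?_
      rw [sub_zero, abs_of_nonneg ht]
      have h5 : 0 < L * t + 1 := by positivity
      rw [show L * (ε / (L * t + 1)) * t = ε * ((L * t) / (L * t + 1)) by ring]
      have h6 : (L * t) / (L * t + 1) < 1 := by rw [div_lt_one h5]; linarith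
      nlinarith
    exact tendsto_nhds_unique ((tendsto_add_atTop_iff_nat 1).2 (hx t ht))
      (h1.const_add (g t))

end SingularSDE

namespace SingularSDE

/-! ### Monotonicity of the drift and contraction -/

section Drift

variable {α : ℝ} {b : ℝ → ℝ}

theorem DriftAssumption.differentiableAt (hb : DriftAssumption α b) {x : ℝ} (hx : 0 < x) :
    DifferentiableAt ℝ b x :=
  (hb.contDiffOn.differentiableOn (by simp)).differentiableAt (Ioi_mem_nhds hx)

theorem DriftAssumption.continuousOn (hb : DriftAssumption α b) : ContinuousOn b (Ioi 0) :=
  hb.contDiffOn.continuousOn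

/-- One-sided Lipschitz condition with constant `-K` on the positive half line. -/
def IsDissipative (K : ℝ) (b : ℝ → ℝ) : Prop :=
  ∀ x y : ℝ, 0 < x → 0 < y → (b x - b y) * (x - y) ≤ -K * (x - y) ^ 2

theorem DriftAssumption.exists_isDissipative (hb : DriftAssumption α b) :
    ∃ K : ℝ, 0 < K ∧ IsDissipative K b := by
  obtain ⟨K, hK, h⟩ := hb.deriv_lt
  refine ⟨K, hK, ?_⟩
  have key : ∀ x y : ℝ, 0 < x → x < y → b y - b x < -K * (y - x) := by
    intro x y hx hxy
    refine Convex.image_sub_lt_mul_sub_of_deriv_lt (convex_Ioi (0 : ℝ)) hb.continuousOn ?_ ?_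
      x hx y (hx.trans hxy) hxy
    · rw [interior_Ioi]
      exact fun z hz => (hb.differentiableAt hz).differentiableWithinAt
    · rw [interior_Ioi]
      exact fun z hz => h z hz
  intro x y hx hy
  rcases lt_trichotomy x y with hxy | rfl | hxy
  · nlinarith [key x y hx hxy]
  · simp
  · nlinarith [key y x hy hxy]

theorem IsDissipative.antitone {K : ℝ} (h : IsDissipative K b) (hK : 0 < K) {x y : ℝ} (hx : 0 < x)
    (hxy : x ≤ y) : b y ≤ b x := by
  rcases hxy.eq_or_lt with rfl | hlt
  · exact le_rfl
  · have h1 := h y x (hx.trans hlt) hx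
    by_contra! h2
    nlinarith [mul_pos (sub_pos.2 h2) (sub_pos.2 hlt), sq_nonneg (y - x)]

/-- Truncating the argument at `ε` only uses `b` on `[ε, ∞)`, where its derivative is bounded; the
result is globally Lipschitz and fits Picard iteration. -/
theorem DriftAssumption.exists_lipschitz (hb : DriftAssumption α b) {ε : ℝ} (hε : 0 < ε) :
    ∃ L : ℝ, 0 ≤ L ∧ ∀ x y : ℝ, |b (max x ε) - b (max y ε)| ≤ L * |x - y| := by
  obtain ⟨M, hM⟩ := hb.bounded_deriv ε hε 1 le_rfl (by omega)
  have hM0 : 0 ≤ M := (abs_nonneg _).trans (hM ε le_rfl)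
  refine ⟨M, hM0, fun x y => ?_⟩
  have h1 : ‖b (max x ε) - b (max y ε)‖ ≤ M * ‖max x ε - max y ε‖ := by
    refine Convex.norm_image_sub_le_of_norm_deriv_le (s := Ici ε)
      (fun z hz => hb.differentiableAt (hε.trans_le hz)) (fun z hz => ?_) (convex_Ici ε)
      (mem_Ici.2 (le_max_right _ _)) (mem_Ici.2 (le_max_right _ _))
    have := hM z hz
    rwa [iteratedDeriv_one] at this
  exact h1.trans (mul_le_mul_of_nonneg_left (abs_max_sub_max_le_abs x y ε) hM0)

/-- A drift negative on all of `(0, ∞)` would have nonpositive integrals along `t ^ α`, against both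
alternatives of the singularity condition. -/
theorem DriftAssumption.exists_nonneg (hb : DriftAssumption α b) :
    ∃ δ : ℝ, 0 < δ ∧ 0 ≤ b δ := by
  by_contra! hneg
  have hn : ∀ t : ℝ, 0 < t → b (1 * t ^ α) ≤ 0 := fun t ht =>
    (hneg _ (by positivity)).le
  rcases hb.singular 1 one_pos with h | h
  · have h1 := h 1 one_pos
    rw [setLIntegral_congr_fun measurableSet_Ioc (g := fun _ => 0)
      (fun t ht => ENNReal.ofReal_of_nonpos (hn t ht.1))] at h1
    simp at h1
  · obtain ⟨T, hT, hT0⟩ := ((h.eventually_ge_atTop 1).and self_mem_nhdsWithin).exists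
    have hT0 : 0 < T := hT0
    have h2 : ∫ t in (0 : ℝ)..T, b (1 * t ^ α) ≤ 0 := by
      rw [intervalIntegral.integral_of_le hT0.le]
      exact setIntegral_nonpos measurableSet_Ioc fun t ht => hn t ht.1
    have h3 : 0 ≤ 1 / T ^ α := by positivity
    nlinarith

end Drift

/-- The energy `d ^ 2 * exp (2 * K * t)` has derivative `2 * (β * d + K * d ^ 2) * exp (2 * K * t) ≤
0`. -/
theorem abs_le_exp_mul_of_dissipative {K T : ℝ} {d β : ℝ → ℝ} (hβ : ContinuousOn β (Icc 0 T))
    (hd : ∀ t ∈ Icc 0 T, d t = d 0 + ∫ s in (0 : ℝ)..t, β s)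
    (hdis : ∀ t ∈ Icc 0 T, β t * d t ≤ -K * d t ^ 2) {t : ℝ} (ht : t ∈ Icc 0 T) :
    |d t| ≤ Real.exp (-K * t) * |d 0| := by
  have hT : 0 ≤ T := ht.1.trans ht.2
  have hdc : ContinuousOn d (Icc 0 T) := by
    have h1 : ContinuousOn (fun t => ∫ s in (0 : ℝ)..t, β s) (uIcc 0 T) :=
      intervalIntegral.continuousOn_primitive_interval
        (by rw [uIcc_of_le hT]; exact hβ.integrableOn_Icc)
    rw [uIcc_of_le hT] at h1
    exact (continuousOn_const.add h1).congr hd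
  have hderiv : ∀ t ∈ Ioo 0 T, HasDerivAt d (β t) t := by
    intro t ht
    have h1 : HasDerivAt (fun u => d 0 + ∫ s in (0 : ℝ)..u, β s) (β t) t := by
      refine (intervalIntegral.integral_hasDerivAt_right ?_ ?_ ?_).const_add _
      · refine ContinuousOn.intervalIntegrable ?_
        rw [uIcc_of_le ht.1.le]
        exact hβ.mono (Icc_subset_Icc_right ht.2.le)
      · exact (hβ.mono Ioo_subset_Icc_self).stronglyMeasurableAtFilter isOpen_Ioo t ht
      · exact (hβ t (Ioo_subset_Icc_self ht)).continuousAt (Icc_mem_nhds ht.1 ht.2)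
    refine h1.congr_of_eventuallyEq ?_
    filter_upwards [Icc_mem_nhds ht.1 ht.2] with u hu using hd u hu
  have hderiv2 : ∀ t ∈ Ioo 0 T, HasDerivAt (fun t => d t ^ 2 * Real.exp (2 * K * t))
      (2 * (β t * d t + K * d t ^ 2) * Real.exp (2 * K * t)) t := by
    intro t ht
    have h1 := (hderiv t ht).pow 2
    have h2 : HasDerivAt (fun t => Real.exp (2 * K * t)) (Real.exp (2 * K * t) * (2 * K)) t := by
      simpa using ((hasDerivAt_id t).const_mul (2 * K)).exp
    refine (h1.mul h2).congr_deriv ?_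
    simp
    ring
  have hanti : AntitoneOn (fun t => d t ^ 2 * Real.exp (2 * K * t)) (Icc 0 T) := by
    refine antitoneOn_of_deriv_nonpos (convex_Icc 0 T) ((hdc.pow 2).mul (by fun_prop)) ?_ ?_
    · rw [interior_Icc]
      exact fun t ht => (hderiv2 t ht).differentiableAt.differentiableWithinAt
    · rw [interior_Icc]
      intro t ht
      rw [(hderiv2 t ht).deriv]
      have := hdis t (Ioo_subset_Icc_self ht)
      exact mul_nonpos_of_nonpos_of_nonneg (by linarith) (Real.exp_pos _).le
  have h0 := hanti ⟨le_rfl, hT⟩ ht ht.1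
  simp only [mul_zero, Real.exp_zero, mul_one] at h0
  have h1 : (|d t| * Real.exp (K * t)) ^ 2 ≤ |d 0| ^ 2 := by
    rw [mul_pow, sq_abs, sq_abs, ← Real.exp_nat_mul,
      show ((2 : ℕ) : ℝ) * (K * t) = 2 * K * t by push_cast; ring]
    exact h0
  have h2 : |d t| * Real.exp (K * t) ≤ |d 0| := le_of_sq_le_sq h1 (abs_nonneg _)
  rw [neg_mul, Real.exp_neg, inv_mul_eq_div, le_div_iff₀ (Real.exp_pos _)]
  exact h2

/-- Two positive solutions with the same noise approach each other exponentially fast. -/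
theorem abs_sub_le_exp_mul_of_eqn {K T σ x₀ y₀ : ℝ} {b w x y : ℝ → ℝ}
    (hbc : ContinuousOn b (Ioi 0)) (hK : IsDissipative K b)
    (hx : ContinuousOn x (Icc 0 T)) (hxp : ∀ t ∈ Icc 0 T, 0 < x t)
    (hxe : ∀ t ∈ Icc 0 T, x t = x₀ + (∫ s in (0 : ℝ)..t, b (x s)) + σ * w t)
    (hy : ContinuousOn y (Icc 0 T)) (hyp : ∀ t ∈ Icc 0 T, 0 < y t)
    (hye : ∀ t ∈ Icc 0 T, y t = y₀ + (∫ s in (0 : ℝ)..t, b (y s)) + σ * w t)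
    {t : ℝ} (ht : t ∈ Icc 0 T) :
    |x t - y t| ≤ Real.exp (-K * t) * |x₀ - y₀| := by
  have hT : 0 ≤ T := ht.1.trans ht.2
  have hbx : ContinuousOn (fun s => b (x s)) (Icc 0 T) := hbc.comp hx hxp
  have hby : ContinuousOn (fun s => b (y s)) (Icc 0 T) := hbc.comp hy hyp
  have h0 : x 0 - y 0 = x₀ - y₀ := by
    rw [hxe 0 ⟨le_rfl, hT⟩, hye 0 ⟨le_rfl, hT⟩]
    simp
  have h := abs_le_exp_mul_of_dissipative (K := K) (d := fun t => x t - y t) (hbx.sub hby)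
    (fun t ht => ?_) (fun t ht => hK _ _ (hxp t ht) (hyp t ht)) ht
  · simpa only [h0] using h
  · have hi : ∀ f : ℝ → ℝ, ContinuousOn f (Icc 0 T) → IntervalIntegrable f volume 0 t :=
      fun f hf => ContinuousOn.intervalIntegrable
        (by rw [uIcc_of_le ht.1]; exact hf.mono (Icc_subset_Icc_right ht.2))
    simp only [Pi.sub_apply]
    rw [intervalIntegral.integral_sub (hi _ hbx) (hi _ hby), h0, hxe t ht, hye t ht]
    ring

end SingularSDE

/-! ### The singular drift keeps solutions away from zero -/

namespace SingularSDE

variable {α : ℝ} {b : ℝ → ℝ}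

theorem continuousOn_comp_add_mul_rpow (hα : 0 < α) (hbc : ContinuousOn b (Ioi 0)) {ε C : ℝ}
    (hε : 0 ≤ ε) (hC : 0 < C) : ContinuousOn (fun u : ℝ => b (ε + C * u ^ α)) (Ioi 0) := by
  refine hbc.comp ((continuous_const.add (continuous_const.mul
    (Real.continuous_rpow_const hα.le))).continuousOn) fun u hu => ?_
  have : 0 < u ^ α := Real.rpow_pos_of_pos hu α
  exact mem_Ioi.2 (by positivity)

/-- A form of the singularity of the drift that is stable under small shifts. -/
theorem DriftAssumption.exists_lt_integral (hα : 0 < α) (hb : DriftAssumption α b) {C δ h₁ : ℝ}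
    (hC : 0 < C) (hh₁ : 0 < h₁) (hδ : ∀ x, 0 < x → x ≤ δ → 0 ≤ b x)
    (hCh : C * h₁ ^ α < δ) :
    ∃ h, 0 < h ∧ h ≤ h₁ ∧ ∃ ε₀, 0 < ε₀ ∧ ε₀ ≤ δ - C * h₁ ^ α ∧ ∀ ε, 0 < ε → ε < ε₀ →
      C * h ^ α < ∫ u in (0 : ℝ)..h, b (ε + C * u ^ α) := by
  by_contra! hcon
  have hbc := hb.continuousOn
  have hmono : ∀ {h u : ℝ}, 0 < h → h ≤ h₁ → u ∈ Ioc 0 h → C * u ^ α ≤ C * h₁ ^ α :=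
    fun hh hh1 hu => mul_le_mul_of_nonneg_left
      (Real.rpow_le_rpow hu.1.le (hu.2.trans hh1) hα.le) hC.le
  have hnn : ∀ {h u ε : ℝ}, 0 < h → h ≤ h₁ → u ∈ Ioc 0 h → 0 ≤ ε → ε ≤ δ - C * h₁ ^ α →
      0 ≤ b (ε + C * u ^ α) := by
    intro h u ε hh hh1 hu hε hεδ
    have h1 := hmono hh hh1 hu
    have : 0 < u ^ α := Real.rpow_pos_of_pos hu.1 α
    exact hδ _ (by positivity) (by linarith)
  have hcont : ∀ {ε : ℝ} (h : ℝ), 0 ≤ ε → ContinuousOn (fun u => b (ε + C * u ^ α)) (Ioc 0 h) :=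
    fun h hε => (continuousOn_comp_add_mul_rpow hα hbc hε hC).mono fun u hu => hu.1
  have hδ' : 0 < δ - C * h₁ ^ α := by linarith
  -- If the claim fails, every `h ≤ h₁` admits levels `ε n → 0` whose integrals are at most `C * h ^
  -- α`. Fatou's lemma carries this bound to `ε = 0`, for all `h ≤ h₁` at once, which contradicts
  -- either alternative of the singularity condition.
  have key : ∀ h, 0 < h → h ≤ h₁ →
      ∫⁻ u in Ioc 0 h, ENNReal.ofReal (b (C * u ^ α)) ≤ ENNReal.ofReal (C * h ^ α) := by
    intro h hh hh1
    have hseq : ∀ n : ℕ, ∃ ε, 0 < ε ∧ ε < min (1 / ((n : ℝ) + 1)) (δ - C * h₁ ^ α) ∧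
        ∫ u in (0 : ℝ)..h, b (ε + C * u ^ α) ≤ C * h ^ α := fun n => by
      have hp : (0 : ℝ) < 1 / ((n : ℝ) + 1) := by positivity
      obtain ⟨ε, h1, h2, h3⟩ := hcon h hh hh1 _ (lt_min hp hδ') (min_le_right _ _)
      exact ⟨ε, h1, h2, h3⟩
    choose ε hε0 hε1 hε2 using hseq
    have hεlim : Tendsto ε atTop (𝓝 0) :=
      squeeze_zero (fun n => (hε0 n).le) (fun n => ((hε1 n).trans_le (min_le_left _ _)).le)
        tendsto_one_div_add_atTop_nhds_zero_nat
    have hle : ∀ n, ∫⁻ u in Ioc 0 h, ENNReal.ofReal (b (ε n + C * u ^ α)) ≤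
        ENNReal.ofReal (C * h ^ α) := by
      intro n
      have hnn' : ∀ u ∈ Ioc 0 h, 0 ≤ b (ε n + C * u ^ α) := fun u hu =>
        hnn hh hh1 hu (hε0 n).le ((hε1 n).trans_le (min_le_right _ _)).le
      have hint : IntegrableOn (fun u => b (ε n + C * u ^ α)) (Ioc 0 h) := by
        refine (ContinuousOn.integrableOn_Icc ?_).mono_set Ioc_subset_Icc_self
        refine hbc.comp ((continuous_const.add (continuous_const.mul
          (Real.continuous_rpow_const hα.le))).continuousOn) fun u hu => ?_
        have : 0 ≤ u ^ α := Real.rpow_nonneg hu.1 α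
        have := hε0 n
        exact mem_Ioi.2 (by positivity)
      rw [← ofReal_integral_eq_lintegral_ofReal hint
        ((ae_restrict_iff' measurableSet_Ioc).2 (ae_of_all _ hnn'))]
      refine ENNReal.ofReal_le_ofReal ?_
      rw [← intervalIntegral.integral_of_le hh.le]
      exact hε2 n
    have hfatou : ∫⁻ u in Ioc 0 h, ENNReal.ofReal (b (C * u ^ α)) ≤
        liminf (fun n => ∫⁻ u in Ioc 0 h, ENNReal.ofReal (b (ε n + C * u ^ α))) atTop := by
      refine le_trans (le_of_eq ?_) (lintegral_liminf_le' fun n =>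
        ((hcont h (hε0 n).le).aemeasurable measurableSet_Ioc).ennreal_ofReal)
      refine setLIntegral_congr_fun measurableSet_Ioc fun u hu => ?_
      have hp : 0 < C * u ^ α := mul_pos hC (Real.rpow_pos_of_pos hu.1 α)
      have h1 : Tendsto (fun n => ε n + C * u ^ α) atTop (𝓝 (C * u ^ α)) := by
        simpa using hεlim.add_const (C * u ^ α)
      exact ((ENNReal.continuous_ofReal.tendsto _).comp
        (((hbc.continuousAt (Ioi_mem_nhds hp)).tendsto).comp h1)).liminf_eq.symm
    exact hfatou.trans (liminf_le_of_le (h := fun c hc => by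
      obtain ⟨n, hn⟩ := hc.exists
      exact hn.trans (hle n)))
  rcases hb.singular C hC with h | h
  · have h1 := key h₁ hh₁ le_rfl
    rw [h h₁ hh₁] at h1
    exact absurd h1 (by simp)
  · obtain ⟨T, hT, hT0, hT1⟩ := ((h.eventually_ge_atTop (C + 1)).and
      (Ioc_mem_nhdsGT hh₁)).exists
    have hnn' : ∀ u ∈ Ioc 0 T, 0 ≤ b (C * u ^ α) := fun u hu => by
      simpa using hnn hT0 hT1 hu le_rfl hδ'.le
    have hpow : 0 < T ^ α := Real.rpow_pos_of_pos hT0 α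
    have h2 : ∫ t in (0 : ℝ)..T, b (C * t ^ α) ≤ C * T ^ α := by
      rw [intervalIntegral.integral_of_le hT0.le, integral_eq_lintegral_of_nonneg_ae
        ((ae_restrict_iff' measurableSet_Ioc).2 (ae_of_all _ hnn'))
        (by simpa using (hcont T le_rfl).aestronglyMeasurable measurableSet_Ioc)]
      exact ENNReal.toReal_le_of_le_ofReal (by positivity) (key T hT0 hT1)
    have h3 : 1 / T ^ α * ∫ t in (0 : ℝ)..T, b (C * t ^ α) ≤ 1 / T ^ α * (C * T ^ α) :=
      mul_le_mul_of_nonneg_left h2 (by positivity)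
    have h4 : 1 / T ^ α * (C * T ^ α) = C := by field_simp
    linarith

/-- Solutions of the equation with truncated drift stay above the truncation level, if this
level is small enough. -/
theorem DriftAssumption.exists_lt_of_truncated (hα : 0 < α) (hb : DriftAssumption α b) {x₀ C : ℝ}
    (hx₀ : 0 < x₀) (hC : 0 < C) :
    ∃ ε₀, 0 < ε₀ ∧ ∀ ε, 0 < ε → ε < ε₀ → ∀ (T : ℝ) (v x : ℝ → ℝ),
      v 0 = 0 → (∀ s ∈ Icc 0 T, ∀ t ∈ Icc 0 T, |v t - v s| ≤ C * |t - s| ^ α) →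
      ContinuousOn x (Icc 0 T) →
      (∀ t ∈ Icc 0 T, x t = x₀ + (∫ s in (0 : ℝ)..t, b (max (x s) ε)) + v t) →
      ∀ t ∈ Icc 0 T, ε < x t := by
  obtain ⟨K, hK0, hK⟩ := hb.exists_isDissipative
  have hanti := fun {x y : ℝ} => hK.antitone (x := x) (y := y) hK0
  have hbc := hb.continuousOn
  obtain ⟨δ₁, hδ₁, hbδ₁⟩ := hb.exists_nonneg
  obtain ⟨δ, hδ0, hδ, hδx⟩ : ∃ δ, 0 < δ ∧ (∀ x, 0 < x → x ≤ δ → 0 ≤ b x) ∧ δ ≤ x₀ :=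
    ⟨min δ₁ x₀, lt_min hδ₁ hx₀,
      fun x hx hxδ => hbδ₁.trans (hanti hx (hxδ.trans (min_le_left _ _))), min_le_right _ _⟩
  -- Chosen so that `C * h₁ ^ α = δ / 2`: the noise needs at least time `h₁` to bring the path from
  -- `δ` down to a level below `δ / 2`.
  have hh₁ : 0 < (δ / (2 * C)) ^ (1 / α) := by positivity
  set h₁ := (δ / (2 * C)) ^ (1 / α) with hh₁def
  have hCh : C * h₁ ^ α = δ / 2 := by
    rw [hh₁def, ← Real.rpow_mul (by positivity), one_div_mul_cancel hα.ne', Real.rpow_one]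
    field_simp
  obtain ⟨h, hh, hhh₁, ε₀, hε₀, hε₀δ, hlt⟩ :=
    hb.exists_lt_integral hα hC hh₁ hδ (by linarith)
  refine ⟨ε₀, hε₀, fun ε hε hεε₀ T v x hv0 hv hx hxe => ?_⟩
  by_contra! hcon
  obtain ⟨t₀, ht₀, hxt₀⟩ := hcon
  have hεδ : ε < δ / 2 := by linarith
  have hT : 0 ≤ T := ht₀.1.trans ht₀.2
  have hx0 : δ ≤ x 0 := by
    rw [hxe 0 ⟨le_rfl, hT⟩, hv0]
    simpa using hδx
  -- `τ` is the first time at level `ε` or below, and `s` the last time before `τ` at level `δ` or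
  -- above; in between the truncated drift is nonnegative.
  obtain ⟨τ, ⟨hτT, hxτ⟩, hτmin⟩ : ∃ τ, IsLeast (Icc 0 T ∩ x ⁻¹' Iic ε) τ :=
    (isCompact_Icc.of_isClosed_subset (hx.preimage_isClosed_of_isClosed isClosed_Icc isClosed_Iic)
      inter_subset_left).exists_isLeast ⟨t₀, ht₀, hxt₀⟩
  have hxlt : ∀ t, 0 ≤ t → t < τ → ε < x t := fun t ht htτ => by
    by_contra! hle
    exact absurd (hτmin ⟨⟨ht, htτ.le.trans hτT.2⟩, hle⟩) (not_le.2 htτ)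
  have hxτ' : ContinuousOn x (Icc 0 τ) := hx.mono (Icc_subset_Icc_right hτT.2)
  obtain ⟨s, ⟨hsτ, hxs⟩, hsmax⟩ : ∃ s, IsGreatest (Icc 0 τ ∩ x ⁻¹' Ici δ) s :=
    (isCompact_Icc.of_isClosed_subset
      (hxτ'.preimage_isClosed_of_isClosed isClosed_Icc isClosed_Ici)
      inter_subset_left).exists_isGreatest ⟨0, ⟨le_rfl, hτT.1⟩, hx0⟩
  have hxδ : ∀ t, s < t → t ≤ τ → x t < δ := fun t hst htτ => by
    by_contra! hle
    exact absurd (hsmax ⟨⟨hsτ.1.trans hst.le, htτ⟩, hle⟩) (not_le.2 hst)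
  have hbx : ContinuousOn (fun r => b (max (x r) ε)) (Icc 0 τ) :=
    hbc.comp (hxτ'.sup continuousOn_const) fun r _ => hε.trans_le (le_max_right _ _)
  have hint : ∀ t ∈ Icc 0 τ, ∀ t' ∈ Icc 0 τ,
      IntervalIntegrable (fun r => b (max (x r) ε)) volume t t' := fun t ht t' ht' =>
    (hbx.mono (uIcc_subset_Icc ht ht')).intervalIntegrable
  have hincr : ∀ t ∈ Icc s τ, (∫ r in t..τ, b (max (x r) ε)) ≤ ε - x t + C * (τ - t) ^ α := by
    intro t ht
    have ht0 : 0 ≤ t := hsτ.1.trans ht.1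
    have htT : t ∈ Icc 0 T := ⟨ht0, ht.2.trans hτT.2⟩
    have h1 := intervalIntegral.integral_add_adjacent_intervals
      (hint 0 ⟨le_rfl, hτT.1⟩ t ⟨ht0, ht.2⟩) (hint t ⟨ht0, ht.2⟩ τ ⟨hτT.1, le_rfl⟩)
    have h2 := hxe t htT
    have h3 := hxe τ hτT
    have h4 := (abs_le.1 (hv t htT τ hτT)).1
    rw [abs_of_nonneg (sub_nonneg.2 ht.2)] at h4
    have h5 : x τ ≤ ε := hxτ
    linarith
  -- Since the drift only pushes up on `[s, τ]`, the noise alone accounts for the descent to `ε`;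
  -- this bounds the path from above backwards from `τ`.
  have hup : ∀ t ∈ Icc s τ, x t ≤ ε + C * (τ - t) ^ α := by
    intro t ht
    have h1 : 0 ≤ ∫ r in t..τ, b (max (x r) ε) := by
      rw [intervalIntegral.integral_of_le ht.2]
      refine setIntegral_nonneg measurableSet_Ioc fun r hr => hδ _ (hε.trans_le (le_max_right _ _))
        (max_le (hxδ r (ht.1.trans_lt hr.1) hr.2).le (by linarith))
    linarith [hincr t ht]
  have hsh : h₁ ≤ τ - s := by
    have h1 := hup s ⟨le_rfl, hsτ.2⟩
    have h2 : δ ≤ x s := hxs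
    have h3 : C * h₁ ^ α ≤ C * (τ - s) ^ α := by linarith
    exact (Real.rpow_le_rpow_iff hh₁.le (sub_nonneg.2 hsτ.2) hα).1
      (le_of_mul_le_mul_left h3 hC)
  have hmem : τ - h ∈ Icc s τ := ⟨by linarith, by linarith⟩
  -- As `b` is decreasing and the path lies below the curve `ε + C * (τ - r) ^ α`, the drift along
  -- the path dominates the drift along the curve. By `hlt` it gains more than `C * h ^ α` on `[τ -
  -- h, τ]`, whereas `hincr` and `x (τ - h) > ε` allow less.
  have hge : (∫ u in (0 : ℝ)..h, b (ε + C * u ^ α)) ≤ ∫ r in (τ - h)..τ, b (max (x r) ε) := by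
    have h1 : (∫ u in (0 : ℝ)..h, b (ε + C * u ^ α)) =
        ∫ r in (τ - h)..τ, b (ε + C * (τ - r) ^ α) := by
      rw [intervalIntegral.integral_comp_sub_left (fun u => b (ε + C * u ^ α)) τ]
      simp
    rw [h1]
    refine intervalIntegral.integral_mono_on hmem.2 ?_
      (hint _ ⟨hsτ.1.trans hmem.1, hmem.2⟩ _ ⟨hτT.1, le_rfl⟩) fun r hr => ?_
    · refine (ContinuousOn.intervalIntegrable ?_)
      rw [uIcc_of_le hmem.2]
      refine hbc.comp ((continuous_const.add (continuous_const.mul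
        ((Real.continuous_rpow_const hα.le).comp
          (continuous_const.sub continuous_id)))).continuousOn) fun u hu => ?_
      have : 0 ≤ (τ - u) ^ α := Real.rpow_nonneg (sub_nonneg.2 hu.2) α
      exact mem_Ioi.2 (by positivity)
    · refine hanti (hε.trans_le (le_max_right _ _)) (max_le (hup r ⟨hmem.1.trans hr.1, hr.2⟩) ?_)
      have : 0 ≤ (τ - r) ^ α := Real.rpow_nonneg (sub_nonneg.2 hr.2) α
      nlinarith
  have h1 := hlt ε hε hεε₀
  have h2 := hincr _ hmem
  rw [sub_sub_cancel] at h2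
  have h3 := hxlt (τ - h) (hsτ.1.trans hmem.1) (by linarith)
  linarith

end SingularSDE

/-! ### The solution map: existence, contraction, flow, growth, measurability -/

namespace SingularSDE

variable {α σ : ℝ} {b w : ℝ → ℝ}

theorem IsLocallyHolder.continuous (hα : 0 < α) (hw : IsLocallyHolder α w) : Continuous w := by
  refine continuous_iff_continuousAt.2 fun t => ?_
  obtain ⟨C, hC⟩ := hw (|t| + 1)
  have h1 : Tendsto (fun s => C * |s - t| ^ α) (𝓝 t) (𝓝 0) := by
    have : Continuous fun s => C * |s - t| ^ α :=
      continuous_const.mul ((Real.continuous_rpow_const hα.le).comp (by fun_prop))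
    simpa [Real.zero_rpow hα.ne'] using this.tendsto t
  have hmem : ∀ s, |s - t| < 1 → s ∈ Icc (-(|t| + 1)) (|t| + 1) := fun s hs => by
    have := abs_lt.1 hs
    exact ⟨by linarith [neg_abs_le t], by linarith [le_abs_self t]⟩
  refine tendsto_iff_dist_tendsto_zero.2 (squeeze_zero' (Eventually.of_forall
    fun s => dist_nonneg) ?_ h1)
  filter_upwards [Metric.ball_mem_nhds t one_pos] with s hs
  rw [Metric.mem_ball, Real.dist_eq] at hs
  exact hC t (hmem t (by simp)) s (hmem s hs)

theorem IsLocallyHolder.exists_pos_bound (hw : IsLocallyHolder α w) (σ T : ℝ) :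
    ∃ C, 0 < C ∧ ∀ s ∈ Icc 0 T, ∀ t ∈ Icc 0 T, |σ * w t - σ * w s| ≤ C * |t - s| ^ α := by
  obtain ⟨C, hC⟩ := hw T
  refine ⟨|σ| * |C| + 1, by positivity, fun s hs t ht => ?_⟩
  have h1 := hC s ⟨by linarith [hs.1, hs.2], hs.2⟩ t ⟨by linarith [ht.1, ht.2], ht.2⟩
  have h2 : 0 ≤ |t - s| ^ α := by positivity
  have h3 : C * |t - s| ^ α ≤ |C| * |t - s| ^ α :=
    mul_le_mul_of_nonneg_right (le_abs_self C) h2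
  rw [← mul_sub, abs_mul, add_mul, one_mul, mul_assoc]
  nlinarith [mul_le_mul_of_nonneg_left (h1.trans h3) (abs_nonneg σ)]

/-- The solution of the equation with drift truncated below the level `1 / (n + 1)`. -/
noncomputable def truncatedSolution (b : ℝ → ℝ) (σ : ℝ) (w : ℝ → ℝ) (x₀ : ℝ) (n : ℕ) (t : ℝ) : ℝ :=
  limUnder atTop fun k =>
    picardIterate (fun x => b (max x (1 / ((n : ℝ) + 1)))) (fun t => x₀ + σ * w t) k t

theorem DriftAssumption.truncatedSolution_spec (hb : DriftAssumption α b) (hw : Continuous w)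
    (x₀ : ℝ) (n : ℕ) :
    ContinuousOn (truncatedSolution b σ w x₀ n) (Ici 0) ∧
    (∀ t, 0 ≤ t → truncatedSolution b σ w x₀ n t = x₀ + (∫ s in (0 : ℝ)..t,
      b (max (truncatedSolution b σ w x₀ n s) (1 / ((n : ℝ) + 1)))) + σ * w t) ∧
    ∀ t, 0 ≤ t → Tendsto (fun k => picardIterate (fun x => b (max x (1 / ((n : ℝ) + 1))))
      (fun t => x₀ + σ * w t) k t) atTop (𝓝 (truncatedSolution b σ w x₀ n t)) := by
  have hn : (0 : ℝ) < 1 / ((n : ℝ) + 1) := by positivity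
  obtain ⟨L, hL, hLip⟩ := hb.exists_lipschitz hn
  obtain ⟨x, hxc, hxe, hxt⟩ := exists_tendsto_picardIterate
    (f := fun x => b (max x (1 / ((n : ℝ) + 1)))) (g := fun t => x₀ + σ * w t) hL hLip
    (by fun_prop)
  have heq : EqOn (truncatedSolution b σ w x₀ n) x (Ici 0) := fun t ht => (hxt t ht).limUnder_eq
  refine ⟨hxc.congr heq, fun t ht => ?_, fun t ht => ?_⟩
  · rw [heq ht, hxe t ht, add_right_comm]
    congr 2
    refine intervalIntegral.integral_congr fun s hs => ?_
    rw [uIcc_of_le ht] at hs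
    rw [heq hs.1]
  · rw [heq ht]
    exact hxt t ht

theorem IsPositiveSolution.eqOn {x₀ : ℝ} {x y : ℝ → ℝ} (hb : DriftAssumption α b)
    (hx : IsPositiveSolution b σ w x₀ x) (hy : IsPositiveSolution b σ w x₀ y) :
    EqOn x y (Ici 0) := by
  obtain ⟨K, -, hK⟩ := hb.exists_isDissipative
  intro t ht
  have h := abs_sub_le_exp_mul_of_eqn hb.continuousOn hK (T := t)
    (hx.continuousOn.mono fun _ h => h.1) (fun t ht => hx.pos t ht.1) (fun t ht => hx.eqn t ht.1)
    (hy.continuousOn.mono fun _ h => h.1) (fun t ht => hy.pos t ht.1) (fun t ht => hy.eqn t ht.1)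
    ⟨ht, le_rfl⟩
  rw [sub_self, abs_zero, mul_zero] at h
  exact sub_eq_zero.1 (abs_nonpos_iff.1 h)

/-- On each `[0, T]` the truncated solutions eventually stay above their truncation level, hence
solve the true equation there and coincide by contraction. The solution is read off at time `t` from
the truncation index `N t` adapted to the interval `[0, t]`. -/
theorem DriftAssumption.exists_isPositiveSolution (hα : 0 < α) (hb : DriftAssumption α b)
    (hw0 : w 0 = 0) (hw : IsLocallyHolder α w) {x₀ : ℝ} (hx₀ : 0 < x₀) :
    ∃ x, IsPositiveSolution b σ w x₀ x ∧
      ∀ t, 0 ≤ t → ∀ᶠ n in atTop, truncatedSolution b σ w x₀ n t = x t := by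
  obtain ⟨K, -, hK⟩ := hb.exists_isDissipative
  have hspec := hb.truncatedSolution_spec (σ := σ) (hw.continuous hα) x₀
  have hpos : ∀ T : ℝ, ∃ N : ℕ, ∀ n : ℕ, N ≤ n → ∀ t ∈ Icc 0 T,
      1 / ((n : ℝ) + 1) < truncatedSolution b σ w x₀ n t := by
    intro T
    obtain ⟨C, hC, hCw⟩ := hw.exists_pos_bound σ T
    obtain ⟨ε₀, hε₀, h⟩ := hb.exists_lt_of_truncated hα hx₀ hC
    obtain ⟨N, hN⟩ := eventually_atTop.1
      ((tendsto_order.1 tendsto_one_div_add_atTop_nhds_zero_nat).2 ε₀ hε₀)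
    exact ⟨N, fun n hn => h _ (by positivity) (hN n hn) T (fun t => σ * w t) _ (by simp [hw0]) hCw
      ((hspec n).1.mono fun _ h => h.1) fun t ht => (hspec n).2.1 t ht.1⟩
  choose N hN using hpos
  have heqn : ∀ T n, N T ≤ n → ∀ t ∈ Icc 0 T, truncatedSolution b σ w x₀ n t =
      x₀ + (∫ s in (0 : ℝ)..t, b (truncatedSolution b σ w x₀ n s)) + σ * w t := by
    intro T n hn t ht
    rw [(hspec n).2.1 t ht.1]
    congr 2
    refine intervalIntegral.integral_congr fun s hs => ?_
    rw [uIcc_of_le ht.1] at hs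
    rw [max_eq_left (hN T n hn s ⟨hs.1, hs.2.trans ht.2⟩).le]
  have hpos' : ∀ T n, N T ≤ n → ∀ t ∈ Icc 0 T, 0 < truncatedSolution b σ w x₀ n t :=
    fun T n hn t ht => lt_trans (by positivity) (hN T n hn t ht)
  have heq : ∀ T n m, N T ≤ n → N T ≤ m → ∀ t ∈ Icc 0 T,
      truncatedSolution b σ w x₀ n t = truncatedSolution b σ w x₀ m t := by
    intro T n m hn hm t ht
    have h := abs_sub_le_exp_mul_of_eqn hb.continuousOn hK
      ((hspec n).1.mono fun _ h => h.1) (hpos' T n hn) (heqn T n hn)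
      ((hspec m).1.mono fun _ h => h.1) (hpos' T m hm) (heqn T m hm) ht
    rw [sub_self, abs_zero, mul_zero] at h
    exact sub_eq_zero.1 (abs_nonpos_iff.1 h)
  have hx : ∀ T, ∀ t ∈ Icc 0 T,
      truncatedSolution b σ w x₀ (N t) t = truncatedSolution b σ w x₀ (N T) t := by
    intro T t ht
    exact (heq t _ (max (N t) (N T)) le_rfl (le_max_left _ _) t ⟨ht.1, le_rfl⟩).trans
      (heq T _ _ (le_max_right _ _) le_rfl t ht)
  refine ⟨fun t => truncatedSolution b σ w x₀ (N t) t, ⟨?_, ?_, ?_⟩, ?_⟩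
  · intro t ht
    have ht : 0 ≤ t := ht
    have h1 : ContinuousOn (fun t => truncatedSolution b σ w x₀ (N t) t) (Icc 0 (t + 1)) :=
      ((hspec (N (t + 1))).1.mono fun _ h => h.1).congr (hx (t + 1))
    refine (h1 t ⟨ht, by linarith⟩).mono_of_mem_nhdsWithin ?_
    rw [← Ici_inter_Iic]
    exact inter_mem self_mem_nhdsWithin (mem_nhdsWithin_of_mem_nhds (Iic_mem_nhds (by linarith)))
  · exact fun t ht => hpos' t _ le_rfl t ⟨ht, le_rfl⟩
  · intro t ht
    rw [heqn t (N t) le_rfl t ⟨ht, le_rfl⟩]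
    congr 2
    refine intervalIntegral.integral_congr fun s hs => ?_
    rw [uIcc_of_le ht] at hs
    rw [hx t s hs]
  · intro t ht
    filter_upwards [eventually_ge_atTop (N t)] with n hn
    exact heq t _ _ hn le_rfl t ⟨ht, le_rfl⟩

theorem itoMap_of_pos {x₀ : ℝ} (hx₀ : 0 < x₀) :
    itoMap b σ w x₀ = positiveSolution b σ w x₀ := by
  funext t
  rw [itoMap, if_pos hx₀]

theorem itoMap_zero (t : ℝ) :
    itoMap b σ w 0 t = limUnder (𝓝[>] (0 : ℝ)) fun y => positiveSolution b σ w y t := by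
  rw [itoMap, if_neg (lt_irrefl _)]

theorem DriftAssumption.isPositiveSolution_itoMap (hα : 0 < α) (hb : DriftAssumption α b)
    (hw0 : w 0 = 0) (hw : IsLocallyHolder α w) {x₀ : ℝ} (hx₀ : 0 < x₀) :
    IsPositiveSolution b σ w x₀ (itoMap b σ w x₀) := by
  have h : ∃ x, IsPositiveSolution b σ w x₀ x :=
    (hb.exists_isPositiveSolution hα hw0 hw hx₀).imp fun _ h => h.1
  rw [itoMap_of_pos hx₀, positiveSolution, dif_pos h]
  exact h.choose_spec

theorem DriftAssumption.eventually_truncatedSolution_eq (hα : 0 < α) (hb : DriftAssumption α b)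
    (hw0 : w 0 = 0) (hw : IsLocallyHolder α w) {x₀ t : ℝ} (hx₀ : 0 < x₀) (ht : 0 ≤ t) :
    ∀ᶠ n in atTop, truncatedSolution b σ w x₀ n t = itoMap b σ w x₀ t := by
  obtain ⟨x, hx, h⟩ := hb.exists_isPositiveSolution (σ := σ) hα hw0 hw hx₀
  rw [← hx.eqOn hb (hb.isPositiveSolution_itoMap hα hw0 hw hx₀) ht]
  exact h t ht

theorem DriftAssumption.abs_itoMap_sub_le_of_pos (hα : 0 < α) (hb : DriftAssumption α b)
    (hw0 : w 0 = 0) (hw : IsLocallyHolder α w) {K x y t : ℝ} (hK : IsDissipative K b)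
    (hx : 0 < x) (hy : 0 < y) (ht : 0 ≤ t) :
    |itoMap b σ w x t - itoMap b σ w y t| ≤ Real.exp (-K * t) * |x - y| := by
  have h1 := hb.isPositiveSolution_itoMap (σ := σ) hα hw0 hw hx
  have h2 := hb.isPositiveSolution_itoMap (σ := σ) hα hw0 hw hy
  exact abs_sub_le_exp_mul_of_eqn hb.continuousOn hK (T := t)
    (h1.continuousOn.mono fun _ h => h.1) (fun t ht => h1.pos t ht.1) (fun t ht => h1.eqn t ht.1)
    (h2.continuousOn.mono fun _ h => h.1) (fun t ht => h2.pos t ht.1) (fun t ht => h2.eqn t ht.1)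
    ⟨ht, le_rfl⟩

/-- At fixed `t` the solution is Lipschitz in its starting point on `(0, ∞)`, hence extends
continuously to `0`. So the `limUnder` in `itoMap` is a genuine limit. -/
theorem DriftAssumption.tendsto_itoMap_zero (hα : 0 < α) (hb : DriftAssumption α b)
    (hw0 : w 0 = 0) (hw : IsLocallyHolder α w) {t : ℝ} (ht : 0 ≤ t) :
    Tendsto (fun y => itoMap b σ w y t) (𝓝[>] 0) (𝓝 (itoMap b σ w 0 t)) := by
  obtain ⟨K, -, hK⟩ := hb.exists_isDissipative
  have hlip : LipschitzOnWith (Real.exp (-K * t)).toNNReal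
      (fun y => positiveSolution b σ w y t) (Ioi 0) := by
    refine LipschitzOnWith.of_dist_le_mul fun x hx y hy => ?_
    rw [Real.coe_toNNReal _ (Real.exp_pos _).le, ← itoMap_of_pos hx, ← itoMap_of_pos hy]
    exact hb.abs_itoMap_sub_le_of_pos hα hw0 hw hK hx hy ht
  obtain ⟨g, hg, hgeq⟩ := hlip.extend_real
  have h1 : Tendsto (fun y => positiveSolution b σ w y t) (𝓝[>] 0) (𝓝 (g 0)) := by
    refine ((hg.continuous.tendsto 0).mono_left nhdsWithin_le_nhds).congr' ?_
    filter_upwards [self_mem_nhdsWithin] with y hy using (hgeq hy).symm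
  rw [itoMap_zero, h1.limUnder_eq]
  refine h1.congr' ?_
  filter_upwards [self_mem_nhdsWithin] with y hy
  rw [itoMap_of_pos hy]

theorem DriftAssumption.abs_itoMap_sub_le (hα : 0 < α) (hb : DriftAssumption α b)
    (hw0 : w 0 = 0) (hw : IsLocallyHolder α w) {K x y t : ℝ} (hK : IsDissipative K b)
    (hx : 0 ≤ x) (hy : 0 ≤ y) (ht : 0 ≤ t) :
    |itoMap b σ w x t - itoMap b σ w y t| ≤ Real.exp (-K * t) * |x - y| := by
  have hid : Tendsto (fun z : ℝ => z) (𝓝[>] 0) (𝓝 0) := tendsto_id.mono_left nhdsWithin_le_nhds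
  have h0 := hb.tendsto_itoMap_zero (σ := σ) hα hw0 hw ht
  have hpos : ∀ x, 0 < x → |itoMap b σ w x t - itoMap b σ w 0 t| ≤
      Real.exp (-K * t) * |x - 0| := fun x hx => by
    refine le_of_tendsto_of_tendsto (h0.const_sub (itoMap b σ w x t)).abs
      ((hid.const_sub x).abs.const_mul (Real.exp (-K * t))) ?_
    filter_upwards [self_mem_nhdsWithin] with z hz
    exact hb.abs_itoMap_sub_le_of_pos hα hw0 hw hK hx hz ht
  rcases hx.eq_or_lt with rfl | hx
  · rcases hy.eq_or_lt with rfl | hy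
    · simp
    · rw [abs_sub_comm, abs_sub_comm 0 y]
      exact hpos y hy
  · rcases hy.eq_or_lt with rfl | hy
    · exact hpos x hx
    · exact hb.abs_itoMap_sub_le_of_pos hα hw0 hw hK hx hy ht

theorem DriftAssumption.itoMap_nonneg (hα : 0 < α) (hb : DriftAssumption α b)
    (hw0 : w 0 = 0) (hw : IsLocallyHolder α w) {x t : ℝ} (hx : 0 ≤ x) (ht : 0 ≤ t) :
    0 ≤ itoMap b σ w x t := by
  have hpos : ∀ x, 0 < x → 0 ≤ itoMap b σ w x t := fun x hx =>
    ((hb.isPositiveSolution_itoMap hα hw0 hw hx).pos t ht).le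
  rcases hx.eq_or_lt with rfl | hx
  · exact ge_of_tendsto (hb.tendsto_itoMap_zero hα hw0 hw ht)
      (by filter_upwards [self_mem_nhdsWithin] with z hz using hpos z hz)
  · exact hpos x hx

/-- The flow property. -/
theorem DriftAssumption.itoMap_add (hα : 0 < α) (hb : DriftAssumption α b)
    (hw0 : w 0 = 0) (hw : IsLocallyHolder α w) {x s t : ℝ} (hx : 0 < x) (hs : 0 ≤ s)
    (ht : 0 ≤ t) :
    itoMap b σ w x (s + t) = itoMap b σ (fun u => w (s + u) - w s) (itoMap b σ w x s) t := by
  have h := hb.isPositiveSolution_itoMap (σ := σ) hα hw0 hw hx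
  have hbx : ContinuousOn (fun r => b (itoMap b σ w x r)) (Ici 0) :=
    hb.continuousOn.comp h.continuousOn fun r hr => h.pos r hr
  have h2 : IsPositiveSolution b σ (fun u => w (s + u) - w s) (itoMap b σ w x s)
      (fun u => itoMap b σ w x (s + u)) := by
    refine ⟨h.continuousOn.comp (by fun_prop) fun u hu => add_nonneg hs hu,
      fun u hu => h.pos _ (add_nonneg hs hu), fun u hu => ?_⟩
    have hi : ∀ p q, 0 ≤ p → 0 ≤ q →
        IntervalIntegrable (fun r => b (itoMap b σ w x r)) volume p q := fun p q hp hq =>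
      (hbx.mono fun r hr => (le_min hp hq).trans hr.1).intervalIntegrable
    have h3 := intervalIntegral.integral_add_adjacent_intervals (hi 0 s le_rfl hs)
      (hi s (s + u) hs (add_nonneg hs hu))
    rw [intervalIntegral.integral_comp_add_left (fun r => b (itoMap b σ w x r)) s, add_zero,
      h.eqn _ (add_nonneg hs hu), h.eqn s hs, ← h3]
    ring
  exact h2.eqOn hb (hb.isPositiveSolution_itoMap hα (by simp) (hw.shift s) (h.pos s hs)) ht

/-- After the last time `s ≤ t` at which the solution is at most `x + 1`, it exceeds `1`, so the
drift is at most `b 1`. Level `x + 1` lies above both `1` and the starting point, so such an `s`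
exists. -/
theorem DriftAssumption.itoMap_le (hα : 0 < α) (hb : DriftAssumption α b)
    (hw0 : w 0 = 0) (hw : IsLocallyHolder α w) {x t S : ℝ} (hx : 0 < x) (ht : 0 ≤ t)
    (hS : ∀ r ∈ Icc 0 t, |w r| ≤ S) :
    itoMap b σ w x t ≤ x + 1 + |b 1| * t + 2 * |σ| * S := by
  obtain ⟨K, hK0, hK⟩ := hb.exists_isDissipative
  have h := hb.isPositiveSolution_itoMap (σ := σ) hα hw0 hw hx
  have hbx : ContinuousOn (fun r => b (itoMap b σ w x r)) (Ici 0) :=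
    hb.continuousOn.comp h.continuousOn fun r hr => h.pos r hr
  have hi : ∀ p q, 0 ≤ p → 0 ≤ q →
      IntervalIntegrable (fun r => b (itoMap b σ w x r)) volume p q := fun p q hp hq =>
    (hbx.mono fun r hr => (le_min hp hq).trans hr.1).intervalIntegrable
  have h0 : itoMap b σ w x 0 ≤ x + 1 := by
    rw [h.eqn 0 le_rfl, hw0]
    simp
  obtain ⟨s, ⟨hst, hxs⟩, hsmax⟩ :
      ∃ s, IsGreatest (Icc 0 t ∩ itoMap b σ w x ⁻¹' Iic (x + 1)) s :=
    (isCompact_Icc.of_isClosed_subset ((h.continuousOn.mono fun _ h => h.1 :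
      ContinuousOn (itoMap b σ w x) (Icc 0 t)).preimage_isClosed_of_isClosed isClosed_Icc
        isClosed_Iic) inter_subset_left).exists_isGreatest ⟨0, ⟨le_rfl, ht⟩, h0⟩
  have hgt : ∀ r, s < r → r ≤ t → x + 1 < itoMap b σ w x r := fun r hsr hrt => by
    by_contra! hle
    exact absurd (hsmax ⟨⟨hst.1.trans hsr.le, hrt⟩, hle⟩) (not_le.2 hsr)
  have h1 : (∫ r in s..t, b (itoMap b σ w x r)) ≤ ∫ _ in s..t, |b 1| := by
    refine intervalIntegral.integral_mono_on_of_le_Ioo hst.2 (hi s t hst.1 ht)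
      intervalIntegrable_const fun r hr => ?_
    exact (hK.antitone hK0 one_pos (by linarith [hgt r hr.1 hr.2.le])).trans (le_abs_self _)
  have h2 := intervalIntegral.integral_add_adjacent_intervals (hi 0 s le_rfl hst.1)
    (hi s t hst.1 ht)
  rw [intervalIntegral.integral_const, smul_eq_mul] at h1
  have h3 := h.eqn t ht
  have h4 := h.eqn s hst.1
  have h5 : itoMap b σ w x s ≤ x + 1 := hxs
  have h6 : |σ * w t - σ * w s| ≤ 2 * |σ| * S := by
    rw [← mul_sub, abs_mul]
    have h7 := abs_sub (w t) (w s)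
    have h8 := hS t ⟨ht, le_rfl⟩
    have h9 := hS s hst
    nlinarith [abs_nonneg σ]
  have h7 := le_abs_self (σ * w t - σ * w s)
  have h8 : (t - s) * |b 1| ≤ |b 1| * t := by nlinarith [abs_nonneg (b 1), hst.1]
  linarith

/-- `positiveSolution` is defined by choice, so measurability comes from approximation: Picard
iterates converge to truncated solutions, these are eventually equal to the solution, and starting
point `0` is a further limit. -/
theorem DriftAssumption.measurable_itoMap (hα : 0 < α) (hb : DriftAssumption α b) {Ω : Type*}
    [MeasurableSpace Ω] {W : Ω → ℝ → ℝ} (hW0 : ∀ ω, W ω 0 = 0)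
    (hW : ∀ ω, IsLocallyHolder α (W ω)) (hWm : ∀ t, Measurable fun ω => W ω t) {x t : ℝ}
    (hx : 0 ≤ x) (ht : 0 ≤ t) : Measurable fun ω => itoMap b σ (W ω) x t := by
  have hpos : ∀ x, 0 < x → Measurable fun ω => itoMap b σ (W ω) x t := by
    intro x hx
    refine measurable_of_tendsto_metrizable (f := fun n ω => truncatedSolution b σ (W ω) x n t)
      (fun n => ?_) (tendsto_pi_nhds.2 fun ω => tendsto_const_nhds.congr' ?_)
    · refine measurable_of_tendsto_metrizable (fun k => measurable_picardIterate ?_ ?_ ?_ k t)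
        (tendsto_pi_nhds.2 fun ω => (hb.truncatedSolution_spec ((hW ω).continuous hα) x n).2.2 t ht)
      · obtain ⟨L, hL, hLip⟩ := hb.exists_lipschitz (ε := 1 / ((n : ℝ) + 1)) (by positivity)
        exact (LipschitzWith.of_dist_le_mul (K := ⟨L, hL⟩) fun x y => hLip x y).continuous
      · have := fun ω => (hW ω).continuous hα
        fun_prop
      · exact fun t => ((hWm t).const_mul σ).const_add x
    · filter_upwards [hb.eventually_truncatedSolution_eq (σ := σ) hα (hW0 ω) (hW ω) hx ht]
        with n hn using hn.symm
  rcases hx.eq_or_lt with rfl | hx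
  · refine measurable_of_tendsto_metrizable
      (f := fun (n : ℕ) ω => itoMap b σ (W ω) (1 / ((n : ℝ) + 1)) t)
      (fun n => hpos _ (by positivity)) (tendsto_pi_nhds.2 fun ω =>
        (hb.tendsto_itoMap_zero hα (hW0 ω) (hW ω) ht).comp (tendsto_nhdsWithin_iff.2
          ⟨tendsto_one_div_add_atTop_nhds_zero_nat, Eventually.of_forall fun n =>
            mem_Ioi.2 (by positivity)⟩))
  · exact hpos x hx

end SingularSDE

/-! ### Gaussian laws and shift invariance of fractional Brownian motion -/

namespace SingularSDE

section Gaussian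

variable {T Ω : Type*} [MeasurableSpace Ω] {P : Measure Ω} {X Y : T → Ω → ℝ}

/-- Real Gaussian processes with the same means and covariances have the same law. -/
theorem map_eq_of_isGaussianProcess (hX : IsGaussianProcess X P) (hY : IsGaussianProcess Y P)
    (hXm : Measurable fun ω t => X t ω) (hYm : Measurable fun ω t => Y t ω)
    (hm : ∀ t, ∫ ω, X t ω ∂P = ∫ ω, Y t ω ∂P)
    (hc : ∀ s t, cov[X s, X t; P] = cov[Y s, Y t; P]) :
    P.map (fun ω t => X t ω) = P.map (fun ω t => Y t ω) := by
  have : IsProbabilityMeasure P := by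
    rcases isEmpty_or_nonempty T with hT | hT
    · exact (hX.hasGaussianLaw ∅).isProbabilityMeasure
    · exact hX.isProbabilityMeasure
  refine (map_eq_iff_forall_finset_map_restrict_eq hXm.aemeasurable hYm.aemeasurable).2 fun I => ?_
  have hXI : Measurable fun ω => I.restrict (X · ω) := (Finset.measurable_restrict I).comp hXm
  have hYI : Measurable fun ω => I.restrict (Y · ω) := (Finset.measurable_restrict I).comp hYm
  -- Each finite-dimensional marginal is moved to a Euclidean space, where a Gaussian measure is
  -- determined by its mean and its covariance form.
  apply (MeasurableEquiv.toLp 2 (I → ℝ)).map_measurableEquiv_injective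
  rw [Measure.map_map (by fun_prop) hXI, Measure.map_map (by fun_prop) hYI]
  have hXg := (hX.hasGaussianLaw I).toLp_pi 2
  have hYg := (hY.hasGaussianLaw I).toLp_pi 2
  have hXM := hXg.isGaussian_map
  have hYM := hYg.isGaussian_map
  change P.map (fun ω => WithLp.toLp 2 (I.restrict (X · ω))) =
    P.map (fun ω => WithLp.toLp 2 (I.restrict (Y · ω)))
  apply IsGaussian.ext
  · rw [integral_map hXg.aemeasurable aestronglyMeasurable_id,
      integral_map hYg.aemeasurable aestronglyMeasurable_id]
    ext i
    have h1 := ContinuousLinearMap.integral_comp_comm (EuclideanSpace.proj (𝕜 := ℝ) i)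
      hXg.integrable
    have h2 := ContinuousLinearMap.integral_comp_comm (EuclideanSpace.proj (𝕜 := ℝ) i)
      hYg.integrable
    exact h1.symm.trans ((hm i).trans h2)
  · rw [← ContinuousLinearMap.toBilinForm_inj]
    refine LinearMap.BilinForm.ext_of_isSymm isPosSemidef_covarianceBilin.isSymm
      isPosSemidef_covarianceBilin.isSymm fun x => ?_
    simp only [ContinuousLinearMap.toBilinForm_apply]
    have e1 := covarianceBilin_apply_pi (μ := P) (X := fun (i : I) ω => X i ω)
      (fun i => (hX.hasGaussianLaw_eval i).memLp_two) x x
    have e2 := covarianceBilin_apply_pi (μ := P) (X := fun (i : I) ω => Y i ω)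
      (fun i => (hY.hasGaussianLaw_eval i).memLp_two) x x
    refine e1.trans (Eq.trans ?_ e2.symm)
    exact Finset.sum_congr rfl fun i _ => Finset.sum_congr rfl fun j _ => by rw [hc i j]

end Gaussian

section FBM

variable {α H : ℝ} {P : Measure (PathSpace α)} [IsProbabilityMeasure P]

theorem IsTwoSidedFBM.covariance_eq {Ω : Type*} [MeasurableSpace Ω] {P : Measure Ω}
    [IsProbabilityMeasure P] {B : ℝ → Ω → ℝ} (h : IsTwoSidedFBM H B P) (s t : ℝ) :
    cov[B s, B t; P] = (|s| ^ (2 * H) + |t| ^ (2 * H) - |t - s| ^ (2 * H)) / 2 := by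
  rw [covariance_eq_sub (h.gaussian.hasGaussianLaw_eval s).memLp_two
    (h.gaussian.hasGaussianLaw_eval t).memLp_two, h.centered, zero_mul, sub_zero]
  exact h.covariance s t

theorem IsTwoSidedFBM.integral_sub {Ω : Type*} [MeasurableSpace Ω] {P : Measure Ω}
    [IsProbabilityMeasure P] {B : ℝ → Ω → ℝ} (h : IsTwoSidedFBM H B P) (s t : ℝ) :
    ∫ ω, (B t ω - B s ω) ∂P = 0 := by
  rw [MeasureTheory.integral_sub (h.gaussian.hasGaussianLaw_eval t).integrable
    (h.gaussian.hasGaussianLaw_eval s).integrable, h.centered, h.centered, sub_zero]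

theorem IsTwoSidedFBM.covariance_shift {Ω : Type*} [MeasurableSpace Ω] {P : Measure Ω}
    [IsProbabilityMeasure P] {B : ℝ → Ω → ℝ} (h : IsTwoSidedFBM H B P) (hH : 0 < H) (r s t : ℝ) :
    cov[fun ω => B (r + s) ω - B r ω, fun ω => B (r + t) ω - B r ω; P] = cov[B s, B t; P] := by
  have hm := fun t => (h.gaussian.hasGaussianLaw_eval t).memLp_two
  rw [covariance_fun_sub_fun_sub (hm _) (hm _) (hm _) (hm _)]
  simp only [h.covariance_eq]
  have e1 : r + t - (r + s) = t - s := by ring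
  have e2 : r - (r + s) = -s := by ring
  have e3 : r + t - r = t := by ring
  rw [e1, e2, e3, abs_neg, sub_self, abs_zero, Real.zero_rpow (by positivity)]
  ring

theorem measurable_wienerShift (r : ℝ) : Measurable (wienerShift r : PathSpace α → PathSpace α) := by
  refine Measurable.subtype_mk (measurable_pi_lambda _ fun u => ?_)
  exact ((measurable_pi_apply (r + u)).comp measurable_subtype_coe).sub
    ((measurable_pi_apply r).comp measurable_subtype_coe)

theorem measurable_canonicalProcess (t : ℝ) : Measurable (canonicalProcess α t) :=
  (measurable_pi_apply t).comp measurable_subtype_coe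

/-- The Wiener shift preserves the law of fractional Brownian motion. -/
theorem IsTwoSidedFBM.measurePreserving_wienerShift (h : IsTwoSidedFBM H (canonicalProcess α) P)
    (hH : 0 < H) (r : ℝ) : MeasurePreserving (wienerShift r) P P := by
  refine ⟨measurable_wienerShift r, ?_⟩
  have hval : Measurable (Subtype.val : PathSpace α → ℝ → ℝ) := measurable_subtype_coe
  have key : P.map (fun ω t => canonicalProcess α (r + t) ω - canonicalProcess α r ω) =
      P.map (fun ω t => canonicalProcess α t ω) :=
    map_eq_of_isGaussianProcess (h.gaussian.shift r) h.gaussian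
      (measurable_pi_lambda _ fun t =>
        (measurable_canonicalProcess _).sub (measurable_canonicalProcess _))
      hval (fun t => by rw [h.integral_sub, h.centered]) (fun s t => h.covariance_shift hH r s t)
  ext s hs
  -- Measurable sets of the path space are preimages of measurable sets of `ℝ → ℝ`, so equality of
  -- the laws on the product space suffices.
  obtain ⟨A, hA, rfl⟩ := hs
  have h1 := congrArg (fun μ => μ A) key
  have h2 : Measurable fun (ω : PathSpace α) t =>
      canonicalProcess α (r + t) ω - canonicalProcess α r ω := hval.comp (measurable_wienerShift r)
  have h3 : Measurable fun (ω : PathSpace α) t => canonicalProcess α t ω := hval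
  simp only [Measure.map_apply h2 hA, Measure.map_apply h3 hA] at h1
  rw [Measure.map_apply (measurable_wienerShift r) (hval hA)]
  exact h1

/-- The increment is a centered Gaussian variable of variance `|t - s| ^ (2 * H)`, that is, `|t - s|
^ H` times a standard one in law. -/
theorem IsTwoSidedFBM.lintegral_increment {Ω : Type*} [MeasurableSpace Ω] {P : Measure Ω}
    [IsProbabilityMeasure P] {B : ℝ → Ω → ℝ} (h : IsTwoSidedFBM H B P) (hH : 0 < H) {q : ℝ}
    (hq : 0 < q) (s t : ℝ) :
    ∫⁻ ω, ‖B t ω - B s ω‖ₑ ^ q ∂P =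
      ENNReal.ofReal (|t - s| ^ (H * q)) * ∫⁻ x, ‖x‖ₑ ^ q ∂gaussianReal 0 1 := by
  have hg : HasGaussianLaw (fun ω => B t ω - B s ω) P := h.gaussian.hasGaussianLaw_fun_sub
  have hm := fun t => (h.gaussian.hasGaussianLaw_eval t).memLp_two
  have hvar : Var[fun ω => B t ω - B s ω; P] = (|t - s| ^ H) ^ 2 := by
    rw [← covariance_self hg.aemeasurable, covariance_fun_sub_fun_sub (hm _) (hm _) (hm _) (hm _)]
    simp only [h.covariance_eq, sub_self, abs_zero]
    rw [Real.zero_rpow (by positivity), abs_sub_comm s t, ← Real.rpow_natCast,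
      ← Real.rpow_mul (abs_nonneg _), mul_comm H]
    push_cast
    ring
  have hmap : P.map (fun ω => B t ω - B s ω) = (gaussianReal 0 1).map (|t - s| ^ H * ·) := by
    rw [hg.map_eq_gaussianReal, h.integral_sub, hvar, gaussianReal_map_const_mul, mul_zero, mul_one]
    congr 1
    exact Real.toNNReal_of_nonneg (sq_nonneg _)
  have hmeas : Measurable fun x : ℝ => ‖x‖ₑ ^ q := by fun_prop
  rw [← lintegral_map' (f := fun x : ℝ => ‖x‖ₑ ^ q) hmeas.aemeasurable hg.aemeasurable, hmap,
    lintegral_map hmeas (by fun_prop)]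
  simp only [enorm_mul, ENNReal.mul_rpow_of_nonneg _ _ hq.le]
  rw [lintegral_const_mul _ hmeas]
  congr 1
  rw [Real.enorm_eq_ofReal (by positivity), ENNReal.ofReal_rpow_of_nonneg (by positivity) hq.le,
    ← Real.rpow_mul (abs_nonneg _)]

end FBM

end SingularSDE

/-! ### Moments of the supremum of fractional Brownian motion -/

namespace SingularSDE

/-- Chaining along dyadic points. -/
theorem enorm_le_tsum_of_dyadic_increments {w : ℝ → ℝ} (hw : Continuous w) (hw0 : w 0 = 0) {T : ℝ}
    {M : ℕ → ENNReal} (h : ∀ n k : ℕ, k < 2 ^ n →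
      ‖w (T * ((k + 1 : ℕ) / 2 ^ n)) - w (T * (k / 2 ^ n))‖ₑ ≤ M n) {t : ℝ} (ht : t ∈ Icc 0 T) :
    ‖w t‖ₑ ≤ ∑' n, M n := by
  have key : ∀ n k : ℕ, k ≤ 2 ^ n →
      ‖w (T * (k / 2 ^ n))‖ₑ ≤ ∑ j ∈ Finset.range (n + 1), M j := by
    intro n
    induction n with
    | zero =>
      intro k hk
      have hk' : k = 0 ∨ k = 1 := by simp at hk; omega
      rcases hk' with rfl | rfl
      · simp [hw0]
      · simpa [hw0] using h 0 0 (by simp)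
    | succ n ih =>
      intro k hk
      have heven : ∀ m : ℕ, T * (((2 * m : ℕ) : ℝ) / 2 ^ (n + 1)) = T * (m / 2 ^ n) := fun m => by
        rw [pow_succ']
        push_cast
        rw [mul_div_mul_left _ _ two_ne_zero]
      rw [Finset.sum_range_succ]
      rw [pow_succ'] at hk
      rcases Nat.even_or_odd' k with ⟨m, rfl | rfl⟩
      · rw [heven]
        exact (ih m (by omega)).trans le_self_add
      -- An odd point of level `n + 1` is one increment away from the point `2 * m`, which already
      -- belongs to level `n`.
      · have h1 := h (n + 1) (2 * m) (by rw [pow_succ']; omega)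
        have h2 := ih m (by omega)
        rw [heven] at h1
        calc ‖w (T * (((2 * m + 1 : ℕ) : ℝ) / 2 ^ (n + 1)))‖ₑ
            = ‖w (T * (m / 2 ^ n)) +
              (w (T * (((2 * m + 1 : ℕ) : ℝ) / 2 ^ (n + 1))) - w (T * (m / 2 ^ n)))‖ₑ := by
              rw [add_sub_cancel]
          _ ≤ _ := (enorm_add_le _ _).trans (add_le_add h2 h1)
  rcases (ht.1.trans ht.2).eq_or_lt with hT | hT
  · have : t = 0 := le_antisymm (hT ▸ ht.2) ht.1
    simp [this, hw0]
  have ha : 0 ≤ t / T := div_nonneg ht.1 hT.le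
  have hlim : Tendsto (fun n : ℕ => T * (((⌊t / T * 2 ^ n⌋₊ : ℕ) : ℝ) / 2 ^ n)) atTop (𝓝 t) := by
    have h1 := ((tendsto_nat_floor_mul_div_atTop (R := ℝ) ha).comp
      (tendsto_pow_atTop_atTop_of_one_lt (one_lt_two (α := ℝ)))).const_mul T
    rwa [mul_div_cancel₀ _ hT.ne'] at h1
  refine le_of_tendsto ((continuous_enorm.tendsto _).comp ((hw.tendsto t).comp hlim))
    (Eventually.of_forall fun n => ?_)
  refine (key n _ ?_).trans (ENNReal.sum_le_tsum _)
  have h1 : t / T * 2 ^ n ≤ ((2 ^ n : ℕ) : ℝ) := by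
    push_cast
    exact mul_le_of_le_one_left (by positivity) ((div_le_one hT).2 ht.2)
  exact (Nat.floor_le_floor h1).trans (Nat.floor_natCast _).le

/-- Kolmogorov's argument: a weighted sum `Z` of `q`-th powers of all dyadic increments has finite
mean, each increment is at most a geometric factor times `Z ^ (1 / q)`, and chaining sums these
factors. -/
theorem IsTwoSidedFBM.exists_memLp_bound {α H : ℝ} {P : Measure (PathSpace α)}
    [IsProbabilityMeasure P] (h : IsTwoSidedFBM H (canonicalProcess α) P) (hα : 0 < α)
    (hH : 0 < H) {q T : ℝ} (hq : 2 < H * q) (hT : 0 ≤ T) :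
    ∃ S : PathSpace α → ℝ, Measurable S ∧ MemLp S (ENNReal.ofReal q) P ∧
      ∀ᵐ ω ∂P, ∀ t ∈ Icc 0 T, |ω.1 t| ≤ S ω := by
  have hq0 : 0 < q := by
    by_contra! hle
    nlinarith
  set D : ℕ → ℕ → PathSpace α → ℝ := fun n k ω =>
    canonicalProcess α (T * ((k + 1 : ℕ) / 2 ^ n)) ω - canonicalProcess α (T * (k / 2 ^ n)) ω
  have hD : ∀ n k, Measurable (D n k) := fun n k =>
    (measurable_canonicalProcess _).sub (measurable_canonicalProcess _)
  -- The decay `2 ^ (-H q n)` of the moments is split in two. One half, `a ^ n`, is spent on the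
  -- decay of individual increments; the other must beat the `2 ^ n` increments of level `n`, which
  -- leaves the ratio `2 ^ (1 - H q / 2) < 1` since `2 < H * q`.
  set a : ENNReal := (2 : ENNReal) ^ (H * q / 2)
  have ha0 : a ≠ 0 := by simp [a]
  have ha1 : a ≠ ⊤ := ENNReal.rpow_ne_top_of_nonneg (by positivity) (by simp)
  have ha2 : 1 < a := ENNReal.one_lt_rpow (by simp) (by positivity)
  set Z : PathSpace α → ENNReal := fun ω =>
    ∑' n, a ^ n * ∑ k ∈ Finset.range (2 ^ n), ‖D n k ω‖ₑ ^ q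
  have hZm : Measurable Z := by
    refine Measurable.tsum fun n => (Finset.measurable_fun_sum _ fun k _ => ?_).const_mul _
    exact (hD n k).enorm.pow_const q
  set c : ENNReal := ∫⁻ x, ‖x‖ₑ ^ q ∂gaussianReal 0 1
  have hc : c ≠ ⊤ := by
    have h1 := (memLp_id_gaussianReal' (μ := 0) (v := 1) (ENNReal.ofReal q) (by simp)).2
    rw [eLpNorm_lt_top_iff_lintegral_rpow_enorm_lt_top (by simpa using hq0) (by simp),
      ENNReal.toReal_ofReal hq0.le] at h1
    exact h1.ne
  have hZ : ∫⁻ ω, Z ω ∂P ≠ ⊤ := by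
    set ρ : ENNReal := (2 : ENNReal) ^ (1 - H * q / 2)
    have hρ : ρ < 1 := ENNReal.rpow_lt_one_of_one_lt_of_neg (by simp) (by linarith)
    have hterm : ∀ n : ℕ, ∫⁻ ω, a ^ n * ∑ k ∈ Finset.range (2 ^ n), ‖D n k ω‖ₑ ^ q ∂P =
        ENNReal.ofReal (T ^ (H * q)) * c * ρ ^ n := by
      intro n
      rw [lintegral_const_mul _ (Finset.measurable_fun_sum _ fun k _ =>
        (hD n k).enorm.pow_const q), lintegral_finsetSum _ fun k _ =>
        (hD n k).enorm.pow_const q]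
      have h1 : ∀ k : ℕ, ∫⁻ ω, ‖D n k ω‖ₑ ^ q ∂P =
          ENNReal.ofReal (T ^ (H * q)) * ((2 : ENNReal) ^ (-(H * q))) ^ n * c := by
        intro k
        rw [h.lintegral_increment hH hq0]
        have e : T * (((k + 1 : ℕ) : ℝ) / 2 ^ n) - T * (k / 2 ^ n) = T * (2⁻¹) ^ n := by
          push_cast
          rw [inv_pow]
          ring
        rw [e, abs_of_nonneg (by positivity), Real.mul_rpow hT (by positivity),
          ENNReal.ofReal_mul (by positivity)]
        congr 2
        rw [← Real.rpow_natCast, ← Real.rpow_mul (by positivity), mul_comm (n : ℝ),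
          Real.rpow_mul (by positivity), Real.rpow_natCast, ENNReal.ofReal_pow (by positivity)]
        congr 1
        rw [ENNReal.rpow_neg, ← ENNReal.inv_rpow,
          ← ENNReal.ofReal_rpow_of_pos (by positivity), ENNReal.ofReal_inv_of_pos (by positivity)]
        simp
      simp only [h1, Finset.sum_const, Finset.card_range, nsmul_eq_mul]
      have h2 : a * 2 * (2 : ENNReal) ^ (-(H * q)) = ρ := by
        have h3 : (2 : ENNReal) = (2 : ENNReal) ^ (1 : ℝ) := by simp
        simp only [a, ρ]
        nth_rewrite 2 [h3]
        rw [← ENNReal.rpow_add _ _ (by simp) (by simp),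
          ← ENNReal.rpow_add _ _ (by simp) (by simp)]
        congr 1
        ring
      rw [← h2]
      push_cast
      ring
    rw [lintegral_tsum fun n => ((Finset.measurable_fun_sum _ fun k _ =>
      (hD n k).enorm.pow_const q).const_mul _).aemeasurable]
    simp only [hterm]
    rw [ENNReal.tsum_mul_left, ENNReal.tsum_geometric]
    refine ENNReal.mul_ne_top (ENNReal.mul_ne_top (by simp) hc) ?_
    exact ENNReal.inv_ne_top.2 (tsub_pos_of_lt hρ).ne'
  set r : ENNReal := a⁻¹ ^ (1 / q)
  have hr : r < 1 := ENNReal.rpow_lt_one (by simpa using ha2) (by positivity)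
  have hbound : ∀ ω : PathSpace α, ∀ t ∈ Icc 0 T,
      ‖ω.1 t‖ₑ ≤ (1 - r)⁻¹ * Z ω ^ (1 / q) := by
    intro ω t ht
    rw [← ENNReal.tsum_geometric, ← ENNReal.tsum_mul_right]
    refine enorm_le_tsum_of_dyadic_increments (ω.2.2.continuous hα) ω.2.1 (fun n k hk => ?_) ht
    have h1 : a ^ n * ‖D n k ω‖ₑ ^ q ≤ Z ω :=
      (mul_le_mul_right (Finset.single_le_sum (f := fun k => ‖D n k ω‖ₑ ^ q)
        (fun _ _ => zero_le) (Finset.mem_range.2 hk)) _).trans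
        (ENNReal.le_tsum (f := fun n => a ^ n * ∑ k ∈ Finset.range (2 ^ n), ‖D n k ω‖ₑ ^ q) n)
    have h2 : ‖D n k ω‖ₑ ^ q ≤ a⁻¹ ^ n * Z ω := by
      rw [← ENNReal.inv_pow]
      exact (ENNReal.mul_le_iff_le_inv (pow_ne_zero n ha0) (ENNReal.pow_ne_top ha1)).1 h1
    have h3 : ‖D n k ω‖ₑ ≤ (a⁻¹ ^ n * Z ω) ^ (1 / q) := by
      rwa [one_div, ENNReal.le_rpow_inv_iff hq0]
    refine h3.trans (le_of_eq ?_)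
    rw [ENNReal.mul_rpow_of_nonneg _ _ (by positivity), ← ENNReal.rpow_natCast,
      ← ENNReal.rpow_mul, mul_comm (n : ℝ), ENNReal.rpow_mul, ENNReal.rpow_natCast]
  have hC : (1 - r)⁻¹ ≠ ⊤ := ENNReal.inv_ne_top.2 (tsub_pos_of_lt hr).ne'
  have hSm : Measurable fun ω => (1 - r)⁻¹ * Z ω ^ (1 / q) := (hZm.pow_const _).const_mul _
  refine ⟨fun ω => ((1 - r)⁻¹ * Z ω ^ (1 / q)).toReal, hSm.ennreal_toReal,
    ⟨hSm.ennreal_toReal.aestronglyMeasurable, ?_⟩, ?_⟩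
  · rw [eLpNorm_lt_top_iff_lintegral_rpow_enorm_lt_top (by simpa using hq0) (by simp),
      ENNReal.toReal_ofReal hq0.le]
    have h1 : ∀ ω, ‖((1 - r)⁻¹ * Z ω ^ (1 / q)).toReal‖ₑ ^ q ≤ (1 - r)⁻¹ ^ q * Z ω := by
      intro ω
      have h2 : ‖((1 - r)⁻¹ * Z ω ^ (1 / q)).toReal‖ₑ ≤ (1 - r)⁻¹ * Z ω ^ (1 / q) := by
        rw [Real.enorm_eq_ofReal ENNReal.toReal_nonneg]
        exact ENNReal.ofReal_toReal_le
      refine (ENNReal.rpow_le_rpow h2 hq0.le).trans (le_of_eq ?_)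
      rw [ENNReal.mul_rpow_of_nonneg _ _ hq0.le, ← ENNReal.rpow_mul,
        one_div_mul_cancel hq0.ne', ENNReal.rpow_one]
    refine (lintegral_mono h1).trans_lt ?_
    rw [lintegral_const_mul _ hZm]
    exact ENNReal.mul_lt_top (ENNReal.rpow_lt_top_of_nonneg hq0.le hC) hZ.lt_top
  · filter_upwards [ae_lt_top hZm hZ] with ω hω t ht
    have h1 : (1 - r)⁻¹ * Z ω ^ (1 / q) ≠ ⊤ :=
      ENNReal.mul_ne_top hC (ENNReal.rpow_ne_top_of_nonneg (by positivity) hω.ne)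
    have h2 := ENNReal.toReal_mono h1 (hbound ω t ht)
    simpa using h2

end SingularSDE

/-! ### Pullbacks and the stationary state -/

namespace SingularSDE

variable {α σ : ℝ} {b : ℝ → ℝ}

theorem wienerShift_wienerShift (s r : ℝ) (ω : PathSpace α) :
    wienerShift s (wienerShift r ω) = wienerShift (r + s) ω := by
  refine Subtype.ext (funext fun u => ?_)
  simp only [wienerShift, add_assoc]
  ring

theorem wienerShift_zero (ω : PathSpace α) : wienerShift 0 ω = ω := by
  refine Subtype.ext (funext fun u => ?_)
  simp [wienerShift, ω.2.1]

theorem wienerShift_neg_cancel (s : ℝ) (ω : PathSpace α) :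
    wienerShift s (wienerShift (-s) ω) = ω := by
  rw [wienerShift_wienerShift, neg_add_cancel, wienerShift_zero]

theorem DriftAssumption.solution_add (hα : 0 < α) (hb : DriftAssumption α b) {x s t : ℝ}
    (hx : 0 < x) (hs : 0 ≤ s) (ht : 0 ≤ t) (ω : PathSpace α) :
    solution b σ x (s + t) ω = solution b σ (solution b σ x s ω) t (wienerShift s ω) :=
  hb.itoMap_add hα ω.2.1 ω.2.2 hx hs ht

theorem DriftAssumption.abs_solution_sub_le (hα : 0 < α) (hb : DriftAssumption α b)
    {K x y t : ℝ} (hK : IsDissipative K b) (hx : 0 ≤ x) (hy : 0 ≤ y) (ht : 0 ≤ t)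
    (ω : PathSpace α) :
    |solution b σ x t ω - solution b σ y t ω| ≤ Real.exp (-K * t) * |x - y| :=
  hb.abs_itoMap_sub_le hα ω.2.1 ω.2.2 hK hx hy ht

theorem DriftAssumption.solution_nonneg (hα : 0 < α) (hb : DriftAssumption α b)
    {x t : ℝ} (hx : 0 ≤ x) (ht : 0 ≤ t) (ω : PathSpace α) : 0 ≤ solution b σ x t ω :=
  hb.itoMap_nonneg hα ω.2.1 ω.2.2 hx ht

theorem DriftAssumption.measurable_solution (hα : 0 < α) (hb : DriftAssumption α b)
    {x t : ℝ} (hx : 0 ≤ x) (ht : 0 ≤ t) :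
    Measurable fun ω : PathSpace α => solution b σ x t ω :=
  hb.measurable_itoMap hα (fun ω => ω.2.1) (fun ω => ω.2.2)
    (fun t => measurable_canonicalProcess t) hx ht

/-- The solution at time `0` when started from `1` at time `-n`. -/
noncomputable def pullback (b : ℝ → ℝ) (σ : ℝ) (n : ℕ) (ω : PathSpace α) : ℝ :=
  solution b σ 1 n (wienerShift (-n) ω)

/-- The state at time `0` of the stationary solution: the limit of the pullbacks. -/
noncomputable def stationaryState (b : ℝ → ℝ) (σ : ℝ) (ω : PathSpace α) : ℝ :=
  -- In `ENNReal` the upper limit exists on every path, so the state is measurable and nonnegative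
  -- everywhere, also off the set of convergence.
  (limsup (fun n : ℕ => ENNReal.ofReal (pullback b σ n ω)) atTop).toReal

theorem stationaryState_nonneg (ω : PathSpace α) : 0 ≤ stationaryState b σ ω :=
  ENNReal.toReal_nonneg

theorem stationaryState_eq_of_tendsto {ω : PathSpace α} {y : ℝ} (hy : 0 ≤ y)
    (h : Tendsto (fun n => pullback b σ n ω) atTop (𝓝 y)) : stationaryState b σ ω = y := by
  have h1 : limsup (fun n : ℕ => ENNReal.ofReal (pullback b σ n ω)) atTop = ENNReal.ofReal y :=
    ((ENNReal.continuous_ofReal.tendsto y).comp h).limsup_eq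
  rw [stationaryState, h1, ENNReal.toReal_ofReal hy]

theorem DriftAssumption.measurable_pullback (hα : 0 < α) (hb : DriftAssumption α b) (n : ℕ) :
    Measurable (pullback b σ n : PathSpace α → ℝ) :=
  (hb.measurable_solution hα zero_le_one n.cast_nonneg).comp (measurable_wienerShift _)

theorem DriftAssumption.measurable_stationaryState (hα : 0 < α) (hb : DriftAssumption α b) :
    Measurable (stationaryState b σ : PathSpace α → ℝ) :=
  (Measurable.limsup fun n => (hb.measurable_pullback hα n).ennreal_ofReal).ennreal_toReal

theorem DriftAssumption.pullback_nonneg (hα : 0 < α) (hb : DriftAssumption α b) (n : ℕ)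
    (ω : PathSpace α) : 0 ≤ pullback b σ n ω :=
  hb.solution_nonneg hα zero_le_one n.cast_nonneg _

theorem DriftAssumption.pullback_succ (hα : 0 < α) (hb : DriftAssumption α b) (n : ℕ)
    (ω : PathSpace α) : pullback b σ (n + 1) ω =
      solution b σ (solution b σ 1 1 (wienerShift (-(n + 1 : ℕ)) ω)) n (wienerShift (-n) ω) := by
  rw [pullback]
  have e : ((n + 1 : ℕ) : ℝ) = 1 + n := by push_cast; ring
  rw [e, hb.solution_add hα one_pos zero_le_one n.cast_nonneg, wienerShift_wienerShift]
  congr 2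
  ring

theorem DriftAssumption.pullback_succ' (hα : 0 < α) (hb : DriftAssumption α b) (n : ℕ)
    (ω : PathSpace α) : pullback b σ (n + 1) ω =
      solution b σ (pullback b σ n (wienerShift (-1) ω)) 1 (wienerShift (-1) ω) := by
  rw [pullback, pullback, wienerShift_wienerShift]
  have e : -1 + -(n : ℝ) = -((n + 1 : ℕ) : ℝ) := by push_cast; ring
  rw [e]
  push_cast
  rw [hb.solution_add hα one_pos n.cast_nonneg zero_le_one, wienerShift_wienerShift]
  congr 2
  ring

/-- The pullbacks from `-n` and `-(n + 1)` are, from time `-n` on, solutions with the same noise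
started from `1` and from a one-step solution. Contraction over time `n` makes the sequence Cauchy.
-/
theorem DriftAssumption.exists_tendsto_pullback (hα : 0 < α) (hb : DriftAssumption α b) {K : ℝ}
    (hK : IsDissipative K b) {ω : PathSpace α}
    (h : Summable fun n : ℕ =>
      Real.exp (-K * n) * |solution b σ 1 1 (wienerShift (-n) ω) - 1|) :
    ∃ y, 0 ≤ y ∧ Tendsto (fun n => pullback b σ n ω) atTop (𝓝 y) := by
  have hle : ∀ n : ℕ, dist (pullback b σ n ω) (pullback b σ n.succ ω) ≤
      Real.exp K * (Real.exp (-K * (n + 1 : ℕ)) *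
        |solution b σ 1 1 (wienerShift (-(n + 1 : ℕ)) ω) - 1|) := by
    intro n
    rw [dist_comm, Real.dist_eq, Nat.succ_eq_add_one, hb.pullback_succ hα, pullback]
    refine (hb.abs_solution_sub_le hα hK (hb.solution_nonneg hα zero_le_one zero_le_one _)
      zero_le_one n.cast_nonneg _).trans (le_of_eq ?_)
    rw [← mul_assoc, ← Real.exp_add]
    congr 2
    push_cast
    ring
  obtain ⟨y, hy⟩ := cauchySeq_tendsto_of_complete
    (cauchySeq_of_dist_le_of_summable _ hle (((summable_nat_add_iff 1).2 h).mul_left _))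
  exact ⟨y, ge_of_tendsto' hy fun n => hb.pullback_nonneg hα n ω, hy⟩

/-- Solutions started from `1` at times `t - n` and `-n` are compared at time `t`: from `t - n` on
they contract for time `n`. The second one passes through the pullback at time `0`, which tends to
`y`. -/
theorem DriftAssumption.tendsto_pullback_wienerShift (hα : 0 < α) (hb : DriftAssumption α b)
    {K : ℝ} (hK : IsDissipative K b) {ω : PathSpace α} {y t : ℝ} (hy : 0 ≤ y) (ht : 0 ≤ t)
    (h : Tendsto (fun n => pullback b σ n ω) atTop (𝓝 y))
    (h' : Tendsto (fun n : ℕ => Real.exp (-K * n) *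
      |solution b σ 1 t (wienerShift (-n) ω) - 1|) atTop (𝓝 0)) :
    Tendsto (fun n => pullback b σ n (wienerShift t ω)) atTop (𝓝 (solution b σ y t ω)) := by
  have h1 : Tendsto (fun n : ℕ => Real.exp (-K * n) *
      |solution b σ 1 t (wienerShift (-n) ω) - 1| +
      Real.exp (-K * t) * |pullback b σ n ω - y|) atTop (𝓝 0) := by
    simpa using h'.add ((h.sub_const y).abs.const_mul (Real.exp (-K * t)))
  refine tendsto_iff_dist_tendsto_zero.2 (squeeze_zero (fun n => dist_nonneg) (fun n => ?_) h1)
  have e1 : solution b σ (solution b σ 1 t (wienerShift (-n) ω)) n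
      (wienerShift (t + -(n : ℝ)) ω) = solution b σ (pullback b σ n ω) t ω := by
    have e2 := hb.solution_add (σ := σ) hα one_pos ht n.cast_nonneg (wienerShift (-(n : ℝ)) ω)
    have e3 := hb.solution_add (σ := σ) hα one_pos n.cast_nonneg ht (wienerShift (-(n : ℝ)) ω)
    rw [wienerShift_wienerShift, add_comm _ t] at e2
    rw [wienerShift_neg_cancel, add_comm _ t] at e3
    exact e2.symm.trans e3
  rw [Real.dist_eq, pullback, wienerShift_wienerShift]
  refine (abs_sub_le _ (solution b σ (pullback b σ n ω) t ω) _).trans (add_le_add ?_ ?_)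
  · rw [← e1, abs_sub_comm (solution b σ 1 t (wienerShift (-n) ω)) 1]
    exact hb.abs_solution_sub_le hα hK zero_le_one (hb.solution_nonneg hα zero_le_one ht _)
      n.cast_nonneg _
  · exact hb.abs_solution_sub_le hα hK (hb.pullback_nonneg hα n ω) hy ht ω

/-- Exponentially damped integrable quantities are summable along measure preserving maps. -/
theorem ae_summable_exp_mul_comp {Ω : Type*} [MeasurableSpace Ω] {P : Measure Ω} {K : ℝ}
    (hK : 0 < K) {θ : ℕ → Ω → Ω}
    (hθ : ∀ n, MeasurePreserving (θ n) P P) {S : Ω → ℝ} (hSm : Measurable S)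
    (hS : Integrable S P) :
    ∀ᵐ ω ∂P, Summable fun n : ℕ => Real.exp (-K * n) * S (θ n ω) := by
  have hm : ∀ n : ℕ, Measurable fun ω => ‖Real.exp (-K * n) * S (θ n ω)‖ₑ := fun n =>
    ((hSm.comp (hθ n).measurable).const_mul _).enorm
  have hr : Real.exp (-K) < 1 := (Real.exp_lt_exp.2 (neg_lt_zero.2 hK)).trans_eq Real.exp_zero
  have hfin : ∫⁻ ω, ∑' n : ℕ, ‖Real.exp (-K * n) * S (θ n ω)‖ₑ ∂P ≠ ⊤ := by
    rw [lintegral_tsum fun n => (hm n).aemeasurable]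
    -- Measure preservation makes the mean of `‖S (θ n ω)‖ₑ` independent of `n`, so the total mean
    -- is a geometric series.
    have h1 : ∀ n : ℕ, ∫⁻ ω, ‖Real.exp (-K * n) * S (θ n ω)‖ₑ ∂P =
        ENNReal.ofReal (Real.exp (-K)) ^ n * ∫⁻ ω, ‖S ω‖ₑ ∂P := by
      intro n
      simp only [enorm_mul]
      have h2 : Measurable fun ω => ‖S (θ n ω)‖ₑ := (hSm.comp (hθ n).measurable).enorm
      rw [lintegral_const_mul _ h2,
        (hθ n).lintegral_comp hSm.enorm, Real.enorm_eq_ofReal (Real.exp_pos _).le,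
        ← ENNReal.ofReal_pow (Real.exp_pos _).le, ← Real.exp_nat_mul, mul_comm (n : ℝ)]
    simp only [h1]
    rw [ENNReal.tsum_mul_right, ENNReal.tsum_geometric]
    refine ENNReal.mul_ne_top (ENNReal.inv_ne_top.2 (tsub_pos_of_lt ?_).ne') hS.2.ne
    rw [← ENNReal.ofReal_one]
    exact (ENNReal.ofReal_lt_ofReal_iff one_pos).2 hr
  filter_upwards [ae_lt_top (Measurable.tsum hm) hfin] with ω hω
  have h1 : Summable fun n : ℕ => ‖Real.exp (-K * n) * S (θ n ω)‖₊ :=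
    ENNReal.tsum_coe_ne_top_iff_summable.1 hω.ne
  exact h1.of_nnnorm

/-! ### Almost sure convergence and moments of the stationary state -/

section Probability

variable {H : ℝ} {P : Measure (PathSpace α)} [IsProbabilityMeasure P]

/-- The solutions started from `1` are bounded, locally uniformly in time, by random variables
with finite moments. -/
theorem IsTwoSidedFBM.exists_memLp_solution_bound (h : IsTwoSidedFBM H (canonicalProcess α) P)
    (hα : 0 < α) (hH : 0 < H) (hb : DriftAssumption α b) (σ : ℝ) {q T : ℝ} (hq : 2 < H * q)
    (hT : 0 ≤ T) :
    ∃ S : PathSpace α → ℝ, Measurable S ∧ MemLp S (ENNReal.ofReal q) P ∧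
      ∀ᵐ ω ∂P, 1 ≤ S ω ∧ ∀ t ∈ Icc 0 T, solution b σ 1 t ω ≤ S ω := by
  obtain ⟨S, hSm, hS, hle⟩ := h.exists_memLp_bound hα hH hq hT
  set c : ℝ := 1 + 1 + |b 1| * T
  have hm : Measurable fun ω => c + (2 * |σ|) * S ω := (hSm.const_mul _).const_add c
  have hp : MemLp (fun ω => c + (2 * |σ|) * S ω) (ENNReal.ofReal q) P :=
    (memLp_const c).add (hS.const_mul (2 * |σ|))
  refine ⟨_, hm, hp, ?_⟩
  filter_upwards [hle] with ω hω
  have hS0 : 0 ≤ S ω := (abs_nonneg _).trans (hω 0 ⟨le_rfl, hT⟩)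
  refine ⟨?_, fun t ht => ?_⟩
  · have h1 : 0 ≤ |b 1| * T := by positivity
    have h2 : 0 ≤ 2 * |σ| * S ω := by positivity
    linarith
  · have h1 : solution b σ 1 t ω ≤ 1 + 1 + |b 1| * t + 2 * |σ| * S ω :=
      hb.itoMap_le hα ω.2.1 ω.2.2 one_pos ht.1 fun r hr => hω r ⟨hr.1, hr.2.trans ht.2⟩
    have h2 : |b 1| * t ≤ |b 1| * T := mul_le_mul_of_nonneg_left ht.2 (abs_nonneg _)
    exact h1.trans (by linarith)

/-- The bound is uniform over `t ∈ [0, N]` and `N` runs over a countable set, so a single null set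
serves all real times `t ≥ 0`. -/
theorem IsTwoSidedFBM.ae_exists_summable_bound (h : IsTwoSidedFBM H (canonicalProcess α) P)
    (hα : 0 < α) (hH : 0 < H) (hH₁ : H < 1) (hb : DriftAssumption α b) (σ : ℝ) {K : ℝ}
    (hK : 0 < K) :
    ∀ᵐ ω ∂P, ∀ N : ℕ, ∃ e : ℕ → ℝ, Summable e ∧ ∀ n : ℕ, ∀ t ∈ Icc 0 (N : ℝ),
      Real.exp (-K * n) * |solution b σ 1 t (wienerShift (-n) ω) - 1| ≤ e n := by
  refine ae_all_iff.2 fun N => ?_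
  -- The exponent `3 / H` meets both requirements: `H * q = 3 > 2`, and `q ≥ 1` because `H < 1`.
  have hq : 2 < H * (3 / H) := by
    rw [mul_div_cancel₀ _ hH.ne']
    norm_num
  obtain ⟨S, hSm, hS, hle⟩ := h.exists_memLp_solution_bound hα hH hb σ hq N.cast_nonneg
  have hq1 : (1 : ℝ) ≤ 3 / H := by
    rw [le_div_iff₀ hH]
    linarith
  have hθ := fun n : ℕ => h.measurePreserving_wienerShift hH (-(n : ℝ))
  filter_upwards [ae_summable_exp_mul_comp hK hθ hSm (hS.integrable (by simpa using hq1)),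
    ae_all_iff.2 fun n => (hθ n).quasiMeasurePreserving.ae hle] with ω hω1 hω2
  refine ⟨_, hω1, fun n t ht => mul_le_mul_of_nonneg_left ?_ (Real.exp_pos _).le⟩
  have h1 := hb.solution_nonneg (σ := σ) hα zero_le_one ht.1 (wienerShift (-(n : ℝ)) ω)
  have h2 := (hω2 n).2 t ht
  have h3 := (hω2 n).1
  exact abs_le.2 ⟨by linarith, by linarith⟩

/-- Almost surely, the pullbacks converge along the whole trajectory, and their limits form a
solution of the equation. -/
theorem IsTwoSidedFBM.ae_tendsto_pullback (h : IsTwoSidedFBM H (canonicalProcess α) P)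
    (hα : 0 < α) (hH : 0 < H) (hH₁ : H < 1) (hb : DriftAssumption α b) (σ : ℝ) :
    ∀ᵐ ω ∂P, Tendsto (fun n => pullback b σ n ω) atTop (𝓝 (stationaryState b σ ω)) ∧
      ∀ t, 0 ≤ t → solution b σ (stationaryState b σ ω) t ω =
        stationaryState b σ (wienerShift t ω) := by
  obtain ⟨K, hK0, hK⟩ := hb.exists_isDissipative
  filter_upwards [h.ae_exists_summable_bound hα hH hH₁ hb σ hK0] with ω hω
  have hs : ∀ t, 0 ≤ t → Summable fun n : ℕ =>
      Real.exp (-K * n) * |solution b σ 1 t (wienerShift (-n) ω) - 1| := fun t ht => by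
    obtain ⟨N, hN⟩ := exists_nat_ge t
    obtain ⟨e, he, hle⟩ := hω N
    exact Summable.of_nonneg_of_le (fun n => by positivity) (fun n => hle n t ⟨ht, hN⟩) he
  obtain ⟨y, hy0, hy⟩ := hb.exists_tendsto_pullback hα hK (hs 1 zero_le_one)
  rw [stationaryState_eq_of_tendsto hy0 hy]
  refine ⟨hy, fun t ht => (stationaryState_eq_of_tendsto (hb.solution_nonneg hα hy0 ht ω) ?_).symm⟩
  exact hb.tendsto_pullback_wienerShift hα hK hy0 ht hy (hs t ht).tendsto_atTop_zero

/-- Over the last unit of time, contraction against the solution started from `1` bounds the new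
pullback by `S + 1 + ρ * (previous pullback)`, evaluated after a measure-preserving shift. With `ρ =
exp (-K) < 1` the norms obey an affine recursion with bounded orbits. -/
theorem IsTwoSidedFBM.exists_eLpNorm_pullback_le (h : IsTwoSidedFBM H (canonicalProcess α) P)
    (hα : 0 < α) (hH : 0 < H) (hb : DriftAssumption α b) (σ : ℝ) {q : ℝ} (hq : 2 < H * q)
    (hq1 : 1 ≤ q) :
    ∃ A : ENNReal, A ≠ ⊤ ∧ ∀ n, eLpNorm (pullback b σ n) (ENNReal.ofReal q) P ≤ A := by
  obtain ⟨K, hK0, hK⟩ := hb.exists_isDissipative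
  obtain ⟨S, hSm, hS, hle⟩ := h.exists_memLp_solution_bound hα hH hb σ hq zero_le_one
  have hθ := h.measurePreserving_wienerShift hH (-1)
  have hp : (1 : ENNReal) ≤ ENNReal.ofReal q := by simpa using hq1
  set ρ : ℝ := Real.exp (-K)
  have hρ0 : 0 < ρ := Real.exp_pos _
  have hρ : ρ < 1 := (Real.exp_lt_exp.2 (neg_lt_zero.2 hK0)).trans_eq Real.exp_zero
  have hS1 : MemLp (fun ω => S ω + 1) (ENNReal.ofReal q) P := hS.add (memLp_const 1)
  set c : ℝ := (eLpNorm (fun ω => S ω + 1) (ENNReal.ofReal q) P).toReal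
  have hc : eLpNorm (fun ω => S ω + 1) (ENNReal.ofReal q) P = ENNReal.ofReal c :=
    (ENNReal.ofReal_toReal hS1.2.ne).symm
  have hc0 : 0 ≤ c := ENNReal.toReal_nonneg
  have hstep : ∀ n, eLpNorm (pullback b σ (n + 1)) (ENNReal.ofReal q) P ≤
      ENNReal.ofReal c + ENNReal.ofReal ρ * eLpNorm (pullback b σ n) (ENNReal.ofReal q) P := by
    intro n
    have hm := hb.measurable_pullback (σ := σ) hα n
    have h1 : ∀ᵐ ω ∂P, ‖pullback b σ (n + 1) ω‖ ≤
        (fun ω => (S ω + 1) + ρ * pullback b σ n ω) (wienerShift (-1) ω) := by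
      filter_upwards [hθ.quasiMeasurePreserving.ae hle] with ω hω
      rw [Real.norm_of_nonneg (hb.pullback_nonneg hα _ ω), hb.pullback_succ' hα]
      have h2 := hb.abs_solution_sub_le (σ := σ) hα hK
        (hb.pullback_nonneg (σ := σ) hα n (wienerShift (-1) ω)) zero_le_one zero_le_one
        (wienerShift (-1) ω)
      rw [mul_one] at h2
      have h3 := hω.2 1 ⟨zero_le_one, le_rfl⟩
      have h4 := (abs_le.1 h2).2
      have h5 : |pullback b σ n (wienerShift (-1) ω) - 1| ≤
          pullback b σ n (wienerShift (-1) ω) + 1 := by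
        have := hb.pullback_nonneg (σ := σ) hα n (wienerShift (-1) ω)
        exact abs_le.2 ⟨by linarith, by linarith⟩
      have h6 := mul_le_mul_of_nonneg_left h5 hρ0.le
      linarith
    refine (eLpNorm_mono_ae_real h1).trans ?_
    have h2 := eLpNorm_comp_measurePreserving (p := ENNReal.ofReal q)
      (g := fun ω => (S ω + 1) + ρ * pullback b σ n ω)
      ((hSm.add_const 1).add (hm.const_mul ρ)).aestronglyMeasurable hθ
    refine h2.le.trans ((eLpNorm_add_le hS1.1
      (hm.const_mul ρ).aestronglyMeasurable hp).trans ?_)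
    rw [hc]
    have h3 := eLpNorm_const_smul ρ (pullback b σ n) (ENNReal.ofReal q) P
    rw [Real.enorm_eq_ofReal hρ0.le] at h3
    exact add_le_add le_rfl h3.le
  have hA0 : 0 < 1 - ρ := by linarith
  -- `c / (1 - ρ)` is the fixed point of the recursion, and `1` is the norm of the initial pullback;
  -- any level above the fixed point is preserved.
  refine ⟨ENNReal.ofReal (max 1 (c / (1 - ρ))), ENNReal.ofReal_ne_top, fun n => ?_⟩
  induction n with
  | zero =>
    have h0 : ∀ ω : PathSpace α, pullback b σ 0 ω = 1 := fun ω => by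
      have h1 := (hb.isPositiveSolution_itoMap (σ := σ) hα (wienerShift (-((0 : ℕ) : ℝ)) ω).2.1
        (wienerShift (-((0 : ℕ) : ℝ)) ω).2.2 one_pos).eqn 0 le_rfl
      rw [(wienerShift (-((0 : ℕ) : ℝ)) ω).2.1] at h1
      rw [pullback]
      refine Eq.trans ?_ (h1.trans (by simp))
      rw [Nat.cast_zero]
      rfl
    rw [funext h0, eLpNorm_const _ (by simpa using by linarith) (NeZero.ne P)]
    simp
  | succ n ih =>
    refine (hstep n).trans ((add_le_add le_rfl (mul_le_mul_right ih _)).trans ?_)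
    rw [← ENNReal.ofReal_mul hρ0.le, ← ENNReal.ofReal_add hc0 (by positivity)]
    refine ENNReal.ofReal_le_ofReal ?_
    have h1 : c ≤ max 1 (c / (1 - ρ)) * (1 - ρ) :=
      (div_le_iff₀ hA0).1 (le_max_right _ _)
    linarith

/-- Fatou's lemma applied to the bounded norms, at an exponent `max p (3 / H)` large enough for the
moment bounds; smaller exponents follow on a probability space. -/
theorem IsTwoSidedFBM.memLp_stationaryState (h : IsTwoSidedFBM H (canonicalProcess α) P)
    (hα : 0 < α) (hH : 0 < H) (hH₁ : H < 1) (hb : DriftAssumption α b) (σ p : ℝ) :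
    MemLp (stationaryState b σ) (ENNReal.ofReal p) P := by
  have hq : 2 < H * max p (3 / H) := by
    have h1 : H * (3 / H) ≤ H * max p (3 / H) := mul_le_mul_of_nonneg_left (le_max_right _ _) hH.le
    rw [mul_div_cancel₀ _ hH.ne'] at h1
    linarith
  have hq1 : 1 ≤ max p (3 / H) := by
    refine le_trans ?_ (le_max_right _ _)
    rw [le_div_iff₀ hH]
    linarith
  obtain ⟨A, hA, hle⟩ := h.exists_eLpNorm_pullback_le hα hH hb σ hq hq1
  have hm := hb.measurable_stationaryState (σ := σ) hα
  refine MemLp.mono_exponent (q := ENNReal.ofReal (max p (3 / H)))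
    ⟨hm.aestronglyMeasurable, ?_⟩ (ENNReal.ofReal_le_ofReal (le_max_left _ _))
  refine lt_of_le_of_lt (Lp.eLpNorm_lim_le_liminf_eLpNorm
    (fun n => (hb.measurable_pullback hα n).aestronglyMeasurable) _
    ((h.ae_tendsto_pullback hα hH hH₁ hb σ).mono fun ω hω => hω.1)) (lt_of_le_of_lt ?_ hA.lt_top)
  exact liminf_le_of_le (h := fun c hc => by
    obtain ⟨n, hn⟩ := hc.exists
    exact hn.trans (hle n))

end Probability

end SingularSDE

/-! ### The main theorem -/

theorem mainTheorem1 (H α σ : ℝ) (hH₁ : H < 1) (hα₀ : 0 < α) (hαH : α < H) (hσ : σ ≠ 0)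
    (b : ℝ → ℝ) (hb : SingularSDE.DriftAssumption α b)
    (P : Measure (SingularSDE.PathSpace α)) [IsProbabilityMeasure P]
    (hP : SingularSDE.IsTwoSidedFBM H (SingularSDE.canonicalProcess α) P) :
    -- the process `X(x₀)` is well defined for `x₀ > 0` ...
    (∀ (ω : SingularSDE.PathSpace α) (x₀ : ℝ), 0 < x₀ →
      SingularSDE.IsPositiveSolution b σ (fun t => SingularSDE.canonicalProcess α t ω) x₀
        (fun t => SingularSDE.solution b σ x₀ t ω) ∧
      ∀ y : ℝ → ℝ,
        SingularSDE.IsPositiveSolution b σ (fun t => SingularSDE.canonicalProcess α t ω) x₀ y →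
        EqOn y (fun t => SingularSDE.solution b σ x₀ t ω) (Ici 0)) ∧
    -- ... and for `x₀ = 0`
    (∀ (ω : SingularSDE.PathSpace α) (T : ℝ), 0 < T →
      TendstoUniformlyOn (fun x₀ t => SingularSDE.solution b σ x₀ t ω)
        (fun t => SingularSDE.solution b σ 0 t ω) (𝓝[>] 0) (Icc 0 T)) ∧
    ∃ X : SingularSDE.PathSpace α → ℝ,
      Measurable X ∧ (∀ ω, 0 ≤ X ω) ∧
      (∀ p : ℝ, 0 < p → MemLp X (ENNReal.ofReal p) P) ∧
      -- `X ∘ θ_T` attracts every solution, almost surely and in every `L^p`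
      (∀ x₀ : ℝ, 0 ≤ x₀ →
        (∀ᵐ ω ∂P, Tendsto (fun T : ℝ =>
          |SingularSDE.solution b σ x₀ T ω - X (SingularSDE.wienerShift T ω)|) atTop (𝓝 0)) ∧
        ∀ p : ℝ, 0 < p →
          (∀ T : ℝ, 0 ≤ T → MemLp (fun ω =>
            SingularSDE.solution b σ x₀ T ω - X (SingularSDE.wienerShift T ω))
            (ENNReal.ofReal p) P) ∧
          Tendsto (fun T : ℝ => eLpNorm (fun ω =>
            SingularSDE.solution b σ x₀ T ω - X (SingularSDE.wienerShift T ω))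
            (ENNReal.ofReal p) P) atTop (𝓝 0)) ∧
      -- `(X ∘ θ_t)_{t ≥ 0}` solves the equation with random initial condition `X` ...
      (∀ᵐ ω ∂P, ∀ t : ℝ, 0 ≤ t →
        SingularSDE.solution b σ (X ω) t ω = X (SingularSDE.wienerShift t ω)) ∧
      -- ... and is a stationary process
      (∀ s : ℝ, 0 ≤ s → IdentDistrib
        (fun ω (t : NNReal) => X (SingularSDE.wienerShift (t + s) ω))
        (fun ω (t : NNReal) => X (SingularSDE.wienerShift t ω)) P P) := by
  have hH : 0 < H := hα₀.trans hαH
  have hsol := fun (ω : SingularSDE.PathSpace α) {x₀ : ℝ} (hx₀ : 0 < x₀) =>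
    hb.isPositiveSolution_itoMap (σ := σ) hα₀ ω.2.1 ω.2.2 hx₀
  refine ⟨fun ω x₀ hx₀ => ⟨hsol ω hx₀, fun y hy => hy.eqOn hb (hsol ω hx₀)⟩,
    fun ω T _ => ?_, SingularSDE.stationaryState b σ, hb.measurable_stationaryState hα₀,
    SingularSDE.stationaryState_nonneg,
    fun p _ => hP.memLp_stationaryState hα₀ hH hH₁ hb σ p, fun x₀ hx₀ => ?_,
    (hP.ae_tendsto_pullback hα₀ hH hH₁ hb σ).mono fun ω hω => hω.2, fun s _ => ?_⟩
  · obtain ⟨K, hK0, hK⟩ := hb.exists_isDissipative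
    rw [Metric.tendstoUniformlyOn_iff]
    intro ε hε
    filter_upwards [Ioo_mem_nhdsGT hε] with x hx t ht
    have h1 := hb.abs_solution_sub_le (σ := σ) hα₀ hK hx.1.le le_rfl ht.1 ω
    have h2 : Real.exp (-K * t) ≤ 1 := by
      rw [Real.exp_le_one_iff]
      nlinarith [ht.1]
    rw [dist_comm, Real.dist_eq]
    rw [sub_zero, abs_of_pos hx.1] at h1
    nlinarith [hx.1, hx.2]
  · obtain ⟨K, hK0, hK⟩ := hb.exists_isDissipative
    have hlim : Tendsto (fun T : ℝ => Real.exp (-K * T)) atTop (𝓝 0) :=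
      Real.tendsto_exp_atBot.comp (tendsto_id.const_mul_atTop_of_neg (neg_lt_zero.2 hK0))
    -- The stationary process is itself the solution started from `stationaryState`, so contraction
    -- yields one pathwise bound that serves both modes of convergence.
    have hae : ∀ᵐ ω ∂P, ∀ T, 0 ≤ T → |SingularSDE.solution b σ x₀ T ω -
        SingularSDE.stationaryState b σ (SingularSDE.wienerShift T ω)| ≤
        Real.exp (-K * T) * |x₀ - SingularSDE.stationaryState b σ ω| := by
      filter_upwards [hP.ae_tendsto_pullback hα₀ hH hH₁ hb σ] with ω hω T hT
      rw [← hω.2 T hT]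
      exact hb.abs_solution_sub_le hα₀ hK hx₀ (SingularSDE.stationaryState_nonneg ω) hT ω
    refine ⟨?_, fun p _ => ?_⟩
    · filter_upwards [hae] with ω hω
      refine squeeze_zero' (Eventually.of_forall fun T => abs_nonneg _)
        ((eventually_ge_atTop 0).mono fun T hT => hω T hT) ?_
      simpa using hlim.mul_const |x₀ - SingularSDE.stationaryState b σ ω|
    · have hX : MemLp (fun ω => x₀ - SingularSDE.stationaryState b σ ω) (ENNReal.ofReal p) P :=
        (memLp_const x₀).sub (hP.memLp_stationaryState hα₀ hH hH₁ hb σ p)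
      have hm : ∀ T, 0 ≤ T → Measurable fun ω : SingularSDE.PathSpace α =>
          SingularSDE.solution b σ x₀ T ω -
            SingularSDE.stationaryState b σ (SingularSDE.wienerShift T ω) := fun T hT =>
        (hb.measurable_solution hα₀ hx₀ hT).sub
          ((hb.measurable_stationaryState hα₀).comp (SingularSDE.measurable_wienerShift T))
      have hle : ∀ T, 0 ≤ T → eLpNorm (fun ω => SingularSDE.solution b σ x₀ T ω -
          SingularSDE.stationaryState b σ (SingularSDE.wienerShift T ω)) (ENNReal.ofReal p) P ≤
          ENNReal.ofReal (Real.exp (-K * T)) *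
            eLpNorm (fun ω => x₀ - SingularSDE.stationaryState b σ ω) (ENNReal.ofReal p) P := by
        intro T hT
        rw [← Real.enorm_eq_ofReal (Real.exp_pos _).le, ← eLpNorm_const_smul]
        refine eLpNorm_mono_ae (hae.mono fun ω hω => ?_)
        rw [Pi.smul_apply, norm_smul, Real.norm_of_nonneg (Real.exp_pos _).le]
        exact hω T hT
      refine ⟨fun T hT => ⟨(hm T hT).aestronglyMeasurable, (hle T hT).trans_lt
        (ENNReal.mul_lt_top ENNReal.ofReal_lt_top hX.2)⟩, ?_⟩
      refine tendsto_of_tendsto_of_tendsto_of_le_of_le' tendsto_const_nhds ?_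
        (Eventually.of_forall fun _ => zero_le) ((eventually_ge_atTop 0).mono hle)
      have h1 := ENNReal.Tendsto.mul_const ((ENNReal.continuous_ofReal.tendsto 0).comp hlim)
        (Or.inr hX.2.ne)
      simpa using h1
  · have hF : Measurable fun (ω : SingularSDE.PathSpace α) (t : NNReal) =>
        SingularSDE.stationaryState b σ (SingularSDE.wienerShift t ω) :=
      measurable_pi_lambda _ fun t =>
        (hb.measurable_stationaryState hα₀).comp (SingularSDE.measurable_wienerShift _)
    have hθ := hP.measurePreserving_wienerShift hH s
    -- The process advanced by `s` is the original one composed with the measure-preserving shift by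
    -- `s`.
    have e : (fun (ω : SingularSDE.PathSpace α) (t : NNReal) =>
        SingularSDE.stationaryState b σ (SingularSDE.wienerShift (t + s) ω)) =
        (fun ω (t : NNReal) => SingularSDE.stationaryState b σ (SingularSDE.wienerShift t ω)) ∘
          SingularSDE.wienerShift s := by
      funext ω t
      simp only [Function.comp_apply, SingularSDE.wienerShift_wienerShift, add_comm s]
    rw [e]
    refine ⟨(hF.comp hθ.measurable).aemeasurable, hF.aemeasurable, ?_⟩
    rw [← Measure.map_map hF hθ.measurable, hθ.map_eq]
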